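/- Let $X$ be a compact Riemann surface with a flat conformal metric with conical singularities: every $p\in X$ has a distinguished holomorphic parameter $\zeta$, $\zeta(p)=0$, in which the metric is $|\zeta|^{2b_p}|d\zeta|^2$ with $b_p>-1$. The conical points are the (finitely many) points of $P=\{p : b_p\neq 0\}$; the cone angle at $p$ is $\theta_p=2\pi(b_p+1)$. In $L^2(X)$, with the area measure and $\langle u,v\rangle=\int_X u\bar v$, let $\Delta$ be the closure of the nonnegative Euclidean Laplacian $-(\partial_x^2+\partial_y^2)$ on $C_0^\infty(X\setminus P)$, $\Delta^*$ its adjoint, $\Delta_F$ its Friedrichs extension, $H^2=\mathrm{dom}(\Delta_F)$, and $\mathcal G(u,v)=\langle\Delta^*u,v\rangle-\langle u,\Delta^*v\rangle$ for $u,v\in\mathrm{dom}(\Delta^*)$. Let $\nu$ range over the pairs of a conical point $p\in P$ and a number $\nu=2\pi k/\theta_p$ with $k\in\mathbb Z$, $|k|<\theta_p/2\pi$ ($k=0$ included). With polar coordinates $r=|\zeta|^{b_p+1}/(b_p+1)$ and $e^{i\nu\theta}=(\zeta/|\zeta|)^k$ at $p$, put $F_\nu=C_\nu r^{-|\nu|}e^{i\nu\theta}\rho_\nu(r)$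 for $k\ne0$ and $F_\nu=C_\nu\ln(r)\,\rho_\nu(r)$ for $k=0$, extended by $0$, where the $C_\nu$ are arbitrary real normalization constants and $\rho_\nu$ is a smooth cut-off function, equal to $1$ near $r=0$ and supported in the domain of $\zeta$. Then $F_\nu\in\mathrm{dom}(\Delta^*)$. Let $\Lambda_\nu(u)=\mathcal G(u,F_\nu)$ for $u\in H^2$. For every $\lambda\in\mathbb C\setminus[0,\infty)$, the operator $\Delta_F-\lambda:H^2\to L^2(X)$ is bijective; put $g_\nu(\cdot\,;\lambda)=-(\Delta_F-\lambda)^{-1}(\Delta^*-\lambda)F_\nu$ and define the S-matrix by $S_{\mu\nu}(\lambda)=\Lambda_\mu(g_\nu(\cdot\,;\lambda))$. Let $G_\nu(\cdot\,;\lambda)=(\Delta_F-\lambda)^{-1}\Lambda_\nu$, that is, the (unique, existing) element of $L^2(X)$ such that $\Lambda_\nu(u)=\langle(\Delta_F-\bar\lambda)u,\,G_\nu(\cdot\,;\lambda)\rangle$ for all $u\in H^2$. Then, for all indices $\mu,\nu$, the function $S_{\mu\nu}$ is complex differentiable on $\mathbb C\setminus[0,\infty)$ and $$\dot S_{\mu\nu}(\lambda)=\langle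 G_\nu(\cdot\,;\lambda),\,G_\mu(\cdot\,;\bar\lambda)\rangle .$$ -/

import Mathlib

open scoped Manifold ContDiff

/-- A flat conformal metric with conical singularities on a Riemann surface `X`, given by its
distinguished local parameters: every point `p` has a holomorphic parameter `ζ`, centred at `p`, in
which the metric is `|ζ|^(2b) |dζ|²` with `b = exponent p > -1`, so that a neighbourhood of `p` is
isometric to a neighbourhood of the tip of the Euclidean cone of total angle `2π(b+1)`.
The local expressions define one and the same metric on overlaps. -/
structure FlatConicalMetric (X : Type*) [TopologicalSpace X] [ChartedSpace ℂ X]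
    [IsManifold 𝓘(ℂ) ω X] where
  /-- the exponent `b` of the metric at a point; it is `0` exactly at the smooth points -/
  exponent : X → ℝ
  exponent_gt : ∀ p, -1 < exponent p
  /-- the distinguished parameter at a point -/
  chart : X → OpenPartialHomeomorph X ℂ
  chart_mem : ∀ p, chart p ∈ IsManifold.maximalAtlas 𝓘(ℂ) ω X
  mem_source : ∀ p, p ∈ (chart p).source
  chart_self : ∀ p, chart p p = 0
  compatible : ∀ p q, ∀ x ∈ (chart p).source ∩ (chart q).source,
    ‖chart q x‖ ^ (2 * exponent q) * ‖deriv (chart q ∘ (chart p).symm) (chart p x)‖ ^ 2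
      = ‖chart p x‖ ^ (2 * exponent p)

/-- The form domain of a nonnegative symmetric operator `T`: all limits in `H` of sequences in
`dom T` which are Cauchy for the quadratic form `u ↦ ⟨T u, u⟩`. (For such `T` the set on the right
is already a linear subspace.) -/
def LinearPMap.formDomain {H : Type*} [NormedAddCommGroup H] [InnerProductSpace ℂ H]
    (T : H →ₗ.[ℂ] H) : Submodule ℂ H :=
  Submodule.span ℂ {u | ∃ φ : ℕ → T.domain,
    Filter.Tendsto (fun n => (φ n : H)) Filter.atTop (nhds u) ∧
    Filter.Tendsto (fun mn : ℕ × ℕ => inner ℂ ((φ mn.1 - φ mn.2 : T.domain) : H)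
      (T (φ mn.1 - φ mn.2))) Filter.atTop (nhds 0)}

/-- The Friedrichs extension of a nonnegative symmetric operator `T`: the restriction of `T†` to
the vectors of `dom T†` that lie in the form domain of `T`. -/
noncomputable def LinearPMap.friedrichs {H : Type*} [NormedAddCommGroup H] [InnerProductSpace ℂ H]
    [CompleteSpace H] (T : H →ₗ.[ℂ] H) : H →ₗ.[ℂ] H :=
  T.adjoint.domRestrict T.formDomain

namespace FlatConicalMetric

section

variable {X : Type*} [TopologicalSpace X] [ChartedSpace ℂ X] [IsManifold 𝓘(ℂ) ω X]
  [MeasurableSpace X] (m : FlatConicalMetric X)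

/-- The Riemannian area of the domain of the distinguished parameter at `p`, as a measure on `X`. -/
noncomputable def localArea (p : X) : MeasureTheory.Measure X :=
  ((MeasureTheory.volume.restrict (m.chart p).target).withDensity
    (fun z : ℂ => ENNReal.ofReal (‖z‖ ^ (2 * m.exponent p)))).map (m.chart p).symm

/-- The Riemannian area measure on `X`. The measures `m.localArea p` are its restrictions to the
domains of the parameters, which are open and cover `X`; so it is their supremum. -/
noncomputable def area : MeasureTheory.Measure X := ⨆ p, m.localArea p

/-- The Hilbert space `L²(X)`. -/
abbrev L2 : Type _ := MeasureTheory.Lp ℂ 2 m.area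

/-- The scalar product `⟨u, v⟩ = ∫ u v̄`, linear in the first argument. -/
noncomputable def pairing (u v : m.L2) : ℂ := inner ℂ v u

/-- `φ` is a smooth function whose (compact) support contains no conical point. -/
def IsTest (φ : X → ℂ) : Prop :=
  (∀ p, ContDiffOn ℝ ∞ (φ ∘ (m.chart p).symm) (m.chart p).target) ∧
    tsupport φ ⊆ {x | m.exponent x = 0}

/-- The (nonnegative) Euclidean Laplacian `-(∂ₓ² + ∂ᵧ²)` on functions. At a smooth point it is
computed in the distinguished parameter `x + iy` at that point, in which the metric is
`dx² + dy²`. (The values at the finitely many conical points are immaterial.) -/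
noncomputable def laplacian (φ : X → ℂ) (x : X) : ℂ :=
  -(Laplacian.laplacian (φ ∘ (m.chart x).symm) (0 : ℂ))

/-- The Laplacian on smooth functions with compact support in the complement of the conical points,
as an unbounded operator on `L²(X)`. (The pairs on the right already form a linear subspace, the
graph of the operator.) -/
noncomputable def laplaceCore : m.L2 →ₗ.[ℂ] m.L2 :=
  (Submodule.span ℂ {uf : m.L2 × m.L2 | ∃ φ : X → ℂ, m.IsTest φ ∧
    uf.1 =ᵐ[m.area] φ ∧ uf.2 =ᵐ[m.area] m.laplacian φ}).toLinearPMap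

/-- `Δ`, the minimal closed extension. -/
noncomputable def laplaceMin : m.L2 →ₗ.[ℂ] m.L2 := m.laplaceCore.closure

/-- `Δ*`, the adjoint of `Δ`. -/
noncomputable def laplaceMax : m.L2 →ₗ.[ℂ] m.L2 := m.laplaceMin.adjoint

/-- `Δ_F`, the Friedrichs extension of `Δ`; its domain is `H²`. -/
noncomputable def laplaceF : m.L2 →ₗ.[ℂ] m.L2 := m.laplaceMin.friedrichs

theorem laplaceF_le_laplaceMax : m.laplaceF ≤ m.laplaceMax :=
  LinearPMap.domRestrict_le

/-- `𝒢(u, v) = ⟨Δ* u, v⟩ - ⟨u, Δ* v⟩` on `dom Δ*`. -/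
noncomputable def greenForm (u v : m.laplaceMax.domain) : ℂ :=
  m.pairing (m.laplaceMax u) v - m.pairing u (m.laplaceMax v)

/-- The set of indices `ν`: a conical point `p`, of total angle `θ = 2π(b+1)`, and an integer `k`
(possibly `0`) with `|k| < θ/(2π)`. The corresponding number `ν` is `2πk/θ`. -/
structure Index where
  point : X
  conical : m.exponent point ≠ 0
  k : ℤ
  k_lt : |(k : ℝ)| < m.exponent point + 1

/-- The number `ν = 2πk/θ = k/(b+1)`. -/
noncomputable def Index.value {m : FlatConicalMetric X} (ν : m.Index) : ℝ :=
  ν.k / (m.exponent ν.point + 1)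

/-- The distance `r = |z|^(b+1)/(b+1)` to `p`, in the metric `|z|^(2b)|dz|²`, of the point with
parameter `z`. -/
noncomputable def radius (p : X) (z : ℂ) : ℝ :=
  ‖z‖ ^ (m.exponent p + 1) / (m.exponent p + 1)

/-- `ρ` is a cut-off function for the conical point `p`: a smooth function of the distance `r` to
`p` which is `1` for small `r` and vanishes for `r ≥ δ`, where the points with `r ≤ δ` are covered
by the distinguished parameter. -/
def IsCutoff (p : X) (ρ : ℝ → ℝ) : Prop :=
  ContDiff ℝ ∞ ρ ∧ (∀ᶠ t in nhds 0, ρ t = 1) ∧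
    ∃ δ : ℝ, (∀ t, δ ≤ t → ρ t = 0) ∧ {z | m.radius p z ≤ δ} ⊆ (m.chart p).target

open Classical in
/-- The function `C r^(-|ν|) exp(iνθ) ρ(r)` for `ν ≠ 0` and `C ln(r) ρ(r)` for `ν = 0`, in polar
coordinates `(r, θ)` at the conical point of `ν`, extended by `0`. In terms of the distinguished
parameter `ζ`, `exp(iνθ) = (ζ/|ζ|)^k`. -/
noncomputable def singularFun (C : ℝ) (ρ : ℝ → ℝ) (ν : m.Index) (x : X) : ℂ :=
  if x ∈ (m.chart ν.point).source then
    let ζ := m.chart ν.point x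
    let r := m.radius ν.point ζ
    if ν.k = 0 then ((C * Real.log r * ρ r : ℝ) : ℂ)
    else ((C * r ^ (-|ν.value|) * ρ r : ℝ) : ℂ) * (ζ / (‖ζ‖ : ℂ)) ^ ν.k
  else 0

variable (C : m.Index → ℝ) (ρ : m.Index → ℝ → ℝ)

/-- `F_ν`: the function above, as an element of `dom Δ*`. -/
noncomputable def F (ν : m.Index) : m.laplaceMax.domain :=
  Classical.epsilon fun u => (u : m.L2) =ᵐ[m.area] m.singularFun (C ν) (ρ ν) ν

/-- The linear functional `Λ_ν = 𝒢(·, F_ν)` on `H²`. -/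
noncomputable def Lam (ν : m.Index) (u : m.laplaceF.domain) : ℂ :=
  m.greenForm ⟨u, m.laplaceF_le_laplaceMax.1 u.2⟩ (m.F C ρ ν)

/-- `Δ_F - lam`, on `H²`. -/
noncomputable def shiftF (lam : ℂ) (u : m.laplaceF.domain) : m.L2 :=
  m.laplaceF u - lam • (u : m.L2)

/-- The resolvent `(Δ_F - lam)⁻¹ : L² → H²`. -/
noncomputable def resolventF (lam : ℂ) : m.L2 → m.laplaceF.domain :=
  Function.invFun (m.shiftF lam)

/-- `G_ν(·; lam) = (Δ_F - lam)⁻¹ Λ_ν`, where `Δ_F - lam` is extended to a map from `L²` to the dual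
`H⁻²` of `H²`: it is the element of `L²` with `Λ_ν(u) = ⟨(Δ_F - conj lam) u, G_ν(·; lam)⟩` for all
`u` in `H²`. -/
noncomputable def G (ν : m.Index) (lam : ℂ) : m.L2 :=
  Classical.epsilon fun v =>
    ∀ u : m.laplaceF.domain, m.Lam C ρ ν u = m.pairing (m.shiftF (starRingEnd ℂ lam) u) v

/-- `f_ν(·; lam) = (Δ* - lam) F_ν`. -/
noncomputable def f (ν : m.Index) (lam : ℂ) : m.L2 :=
  m.laplaceMax (m.F C ρ ν) - lam • (m.F C ρ ν : m.L2)

/-- `g_ν(·; lam) = -(Δ_F - lam)⁻¹ f_ν(·; lam)`. -/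
noncomputable def g (ν : m.Index) (lam : ℂ) : m.laplaceF.domain :=
  -m.resolventF lam (m.f C ρ ν lam)

/-- The S-matrix, `S_{μν}(lam) = Λ_μ(g_ν(·; lam))`. -/
noncomputable def S (μ ν : m.Index) (lam : ℂ) : ℂ :=
  m.Lam C ρ μ (m.g C ρ ν lam)

end

end FlatConicalMetric

-- The heart of the matter is a resolvent identity. Expand `𝒢(u, F_ν)`, replace `(Δ* - λ)F_ν` by
-- `-(Δ_F - λ)g_ν(λ)` and move `Δ_F - λ` across the scalar product: this gives `Λ_ν(u) = ⟨(Δ_F -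
-- λ̄)u, F_ν + g_ν(λ)⟩` (`Lam_eq`). As `Δ_F - λ̄` is onto, `G_ν(λ) = F_ν + g_ν(λ)` (`G_eq`).
-- Subtracting the equations for `g_ν` at `z` and at `λ` gives `(Δ_F - z)(g_ν(z) - g_ν(λ)) = (z -
-- λ)G_ν(λ)` (`shiftF_g_sub_g`). Applying `Λ_μ`, represented by `G_μ(z̄)`, yields the exact formula
-- `S(z) - S(λ) = (z - λ)⟨G_ν(λ), G_μ(z̄)⟩`, so that the derivative only requires continuity of
-- `G_μ` (`continuousAt_G`, `hasDerivAt_S`).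
--
-- The operator theory behind this uses only that `Δ` is densely defined, symmetric and nonnegative.
-- Completing the domain of such an operator `T` in the norm `⟨Tu, u⟩ + ‖u‖²` gives a Hilbert space
-- with a contraction `J` into `H`; then `JJ*` is the inverse of `T_F + 1`
-- (`LinearPMap.exists_friedrichs_add_one_inverse`). It is positive of norm at most `1`, so its
-- spectrum lies in `[0, 1]`, and hence `T_F - λ` is invertible for `λ` off `[0, ∞)`
-- (`LinearPMap.exists_friedrichs_resolvent`).
--
-- The geometry has to supply those three properties and the membership of `F_ν` in `dom Δ*`. The
-- conformal factors of the Laplacian and of the area cancel, so Green's identity on `X` reduces to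
-- the plane by a partition of unity (`integral_laplacian_mul`); this gives symmetry. Nonnegativity
-- follows by integrating `Δ|φ|² ≥ 2 Re(φ̄ Δφ)`, and density holds because the conical points form a
-- null set. Finally `F_ν` is harmonic near its conical point, and square integrable because `|ν| <
-- 1`; Green's identity then places it in `dom Δ*` (`exists_mem_laplaceMax`, `F_ae_eq`).

universe u

/-! ### The Friedrichs extension of an abstract operator and its resolvent -/

open Filter Topology in
/-- Completion of a vector space with respect to an inner product dominating a linear map `L` into a
Hilbert space; `L` extends to the completion. -/
theorem InnerProductSpace.Core.exists_completion {V : Type u} [AddCommGroup V] [Module ℂ V]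
    {H : Type*} [NormedAddCommGroup H] [InnerProductSpace ℂ H] [CompleteSpace H]
    (c : InnerProductSpace.Core ℂ V) (L : V →ₗ[ℂ] H)
    (hL : ∀ v, ‖L v‖ ^ 2 ≤ (c.inner v v).re) :
    ∃ (Q : Type u) (_ : NormedAddCommGroup Q) (_ : InnerProductSpace ℂ Q) (_ : CompleteSpace Q)
      (ι : V →ₗ[ℂ] Q) (J : Q →L[ℂ] H), DenseRange ι ∧ (∀ v, J (ι v) = L v) ∧ ‖J‖ ≤ 1 ∧
        ∀ u v, inner ℂ (ι u) (ι v) = c.inner u v := by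
  let _ : NormedAddCommGroup V := c.toNormedAddCommGroup
  let _ : InnerProductSpace ℂ V := InnerProductSpace.ofCore c.toCore
  have hn : ∀ v : V, ‖L v‖ ≤ 1 * ‖v‖ := fun v => by
    rw [one_mul]
    refine abs_le_of_sq_le_sq' ?_ (norm_nonneg _) |>.2
    exact (hL v).trans_eq (inner_self_eq_norm_sq (𝕜 := ℂ) v)
  let L' : V →L[ℂ] H := L.mkContinuous 1 hn
  let ι : V →L[ℂ] UniformSpace.Completion V := UniformSpace.Completion.toComplL
  have hd : DenseRange ι := UniformSpace.Completion.denseRange_coe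
  have hu : IsUniformInducing ι := UniformSpace.Completion.isUniformInducing_coe V
  have hJ : ∀ v, L'.extend ι (ι v) = L v := fun v => L'.extend_eq hd hu v
  refine ⟨UniformSpace.Completion V, inferInstance, inferInstance, inferInstance, ι, 
    L'.extend ι, hd, hJ, ?_, fun u v => ?_⟩
  · refine ContinuousLinearMap.opNorm_le_bound _ zero_le_one fun x => ?_
    refine hd.induction_on (p := fun x => ‖L'.extend ι x‖ ≤ 1 * ‖x‖) x
      (isClosed_le (by fun_prop) (by fun_prop)) fun v => ?_
    rw [hJ]
    exact (hn v).trans_eq (by rw [show ‖ι v‖ = ‖v‖ from UniformSpace.Completion.norm_coe v])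
  · exact UniformSpace.Completion.inner_coe u v

namespace LinearPMap

variable {H : Type*} [NormedAddCommGroup H] [InnerProductSpace ℂ H]

/-- The inner product `⟨T u, v⟩ + ⟨u, v⟩` on the domain of a nonnegative symmetric operator. -/
@[reducible] noncomputable def formCore (T : H →ₗ.[ℂ] H) (hsym : T.IsFormalAdjoint T)
    (hpos : ∀ u : T.domain, 0 ≤ (inner ℂ (u : H) (T u)).re) :
    InnerProductSpace.Core ℂ T.domain where
  inner u v := inner ℂ (u : H) (T v) + inner ℂ (u : H) v
  conj_inner_symm u v := by
    rw [_root_.map_add, inner_conj_symm, inner_conj_symm, hsym]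
  re_inner_nonneg u := by
    have h1 := hpos u
    have h2 : 0 ≤ (inner ℂ (u : H) (u : H)).re := inner_self_nonneg (𝕜 := ℂ)
    simpa using add_nonneg h1 h2
  add_left u v w := by simp only [Submodule.coe_add, inner_add_left]; ring
  smul_left u v r := by simp only [Submodule.coe_smul, inner_smul_left]; ring
  definite u hu := by
    have h1 := hpos u
    have h2 : (inner ℂ (u : H) (u : H)).re = ‖(u : H)‖ ^ 2 := inner_self_eq_norm_sq (𝕜 := ℂ) _
    have h3 := congrArg Complex.re hu
    simp only [Complex.add_re, Complex.zero_re] at h3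
    have h4 : ‖(u : H)‖ ^ 2 = 0 := by nlinarith [sq_nonneg ‖(u : H)‖]
    simpa using h4

variable [CompleteSpace H] {T : H →ₗ.[ℂ] H}

theorem friedrichs_mem {u : H} (h1 : u ∈ T.formDomain) {w : H}
    (h2 : ∀ v : T.domain, inner ℂ w (v : H) = inner ℂ u (T v)) : u ∈ T.friedrichs.domain :=
  ⟨h1, mem_adjoint_domain_of_exists u ⟨w, h2⟩⟩

theorem friedrichs_le_adjoint (T : H →ₗ.[ℂ] H) : T.friedrichs ≤ T.adjoint := domRestrict_le

theorem friedrichs_inner (hT : Dense (T.domain : Set H)) (u : T.friedrichs.domain) (v : T.domain) :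
    inner ℂ (T.friedrichs u) (v : H) = inner ℂ (u : H) (T v) := by
  have : T.friedrichs u = T.adjoint ⟨u, u.2.2⟩ := T.friedrichs_le_adjoint.2 rfl
  rw [this]
  exact adjoint_isFormalAdjoint hT ⟨u, u.2.2⟩ v

open Filter Topology in
/-- The Friedrichs extension of a densely defined nonnegative symmetric operator, increased by `1`,
has a bounded inverse, which is positive and a contraction. -/
theorem exists_friedrichs_add_one_inverse (hT : Dense (T.domain : Set H))
    (hsym : T.IsFormalAdjoint T) (hpos : ∀ u : T.domain, 0 ≤ (inner ℂ (u : H) (T u)).re) :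
    ∃ A : H →L[ℂ] H, A.IsPositive ∧ ‖A‖ ≤ 1 ∧
      (∀ x, ∃ u : T.friedrichs.domain, (u : H) = A x ∧ T.friedrichs u + u = x) ∧
      ∀ u : T.friedrichs.domain, A (T.friedrichs u + u) = u := by
  have hnorm : ∀ v : T.domain, (inner ℂ (v : H) (v : H)).re = ‖(v : H)‖ ^ 2 := fun v =>
    inner_self_eq_norm_sq (𝕜 := ℂ) _
  obtain ⟨Q, _, _, _, ι, J, hd, hJ, hJ1, hin⟩ :=
    (T.formCore hsym hpos).exists_completion T.domain.subtype fun v => by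
      have h1 := hpos v
      have h2 := hnorm v
      change ‖(v : H)‖ ^ 2 ≤ (inner ℂ (v : H) (T v) + inner ℂ (v : H) (v : H)).re
      rw [Complex.add_re]
      linarith
  replace hin : ∀ u v : T.domain, inner ℂ (ι u) (ι v) = inner ℂ (u : H) (T v + v) := fun u v => by
    rw [hin, inner_add_right]; rfl
  replace hJ : ∀ v : T.domain, J (ι v) = v := hJ
  -- On the dense image of `ι` this is the definition of the inner product of `Q`; both sides are
  -- continuous in `w`.
  have key : ∀ (w : Q) (v : T.domain), inner ℂ (J w) (T v + v) = inner ℂ w (ι v) := by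
    intro w v
    refine hd.induction_on (p := fun w => inner ℂ (J w) (T v + v) = inner ℂ w (ι v)) w
      (isClosed_eq (by fun_prop) (by fun_prop)) fun u => ?_
    rw [hJ, hin]
  -- The squared norm of `Q` is the form plus `‖·‖²`, so convergence in `H` together with being
  -- form-Cauchy amounts to being Cauchy in `Q`.
  have hform : T.formDomain = LinearMap.range J.toLinearMap := by
    apply le_antisymm
    · refine Submodule.span_le.2 ?_
      rintro u ⟨φ, hφ, hc⟩
      have hcs : CauchySeq fun n => ι (φ n) := by
        rw [cauchySeq_iff_tendsto_dist_atTop_0]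
        have hd2 : Tendsto (fun mn : ℕ × ℕ => dist (ι (φ mn.1)) (ι (φ mn.2)) ^ 2) atTop (𝓝 0) := by
          have h1 : Tendsto (fun mn : ℕ × ℕ => ‖((φ mn.1 : H) - φ mn.2)‖ ^ 2) atTop (𝓝 0) := by
            have hp := cauchySeq_iff_tendsto_dist_atTop_0.1 hφ.cauchySeq
            simpa [dist_eq_norm] using hp.pow 2
          have h2 := (Complex.continuous_re.tendsto _).comp hc
          have h3 := h2.add h1
          simp only [Complex.zero_re, add_zero] at h3
          refine h3.congr fun mn => ?_
          have h4 : (inner ℂ (ι (φ mn.1 - φ mn.2)) (ι (φ mn.1 - φ mn.2))).re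
              = ‖ι (φ mn.1 - φ mn.2)‖ ^ 2 := inner_self_eq_norm_sq (𝕜 := ℂ) _
          rw [dist_eq_norm, ← _root_.map_sub, ← h4, hin, inner_add_right, ← Submodule.coe_sub,
            ← hnorm]
          rfl
        have := hd2.sqrt
        simpa [Real.sqrt_sq dist_nonneg] using this
      obtain ⟨w, hw⟩ := cauchySeq_tendsto_of_complete hcs
      refine ⟨w, ?_⟩
      have h1 : Tendsto (fun n => J (ι (φ n))) atTop (𝓝 (J w)) := (J.continuous.tendsto w).comp hw
      simp only [hJ] at h1
      exact tendsto_nhds_unique h1 hφ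
    · rintro u ⟨w, rfl⟩
      refine Submodule.subset_span ?_
      obtain ⟨s, hs, hs'⟩ := mem_closure_iff_seq_limit.1 (hd w)
      choose φ hφ using hs
      have hw : Tendsto (fun n => ι (φ n)) atTop (𝓝 w) := by simpa [hφ] using hs'
      have hJw : Tendsto (fun n => (φ n : H)) atTop (𝓝 (J w)) := by
        have := (J.continuous.tendsto w).comp hw
        simpa [Function.comp_def, hJ] using this
      refine ⟨φ, hJw, ?_⟩
      have e : ∀ x : T.domain, inner ℂ (x : H) (T x) = inner ℂ (ι x) (ι x) - inner ℂ (x : H) x := by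
        intro x
        rw [hin, inner_add_right]; ring
      simp only [e]
      simp only [_root_.map_sub, Submodule.coe_sub]
      have t1 : Tendsto (fun mn : ℕ × ℕ => ι (φ mn.1) - ι (φ mn.2)) atTop (𝓝 0) := by
        rw [← prod_atTop_atTop_eq, ← sub_self w]
        exact (hw.comp tendsto_fst).sub (hw.comp tendsto_snd)
      have t2 : Tendsto (fun mn : ℕ × ℕ => (φ mn.1 : H) - φ mn.2) atTop (𝓝 0) := by
        rw [← prod_atTop_atTop_eq, ← sub_self (J w)]
        exact (hJw.comp tendsto_fst).sub (hJw.comp tendsto_snd)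
      have := (t1.inner t1 (𝕜 := ℂ)).sub (t2.inner t2 (𝕜 := ℂ))
      simpa only [inner_zero_left, sub_zero] using this
  -- By `key`, `⟨JJ*x, (T + 1)v⟩ = ⟨J*x, ιv⟩ = ⟨x, v⟩`, which says that `JJ*x` lies in `dom T†` and
  -- `(T† + 1)JJ*x = x`.
  have hfix : ∀ x, ∃ u : T.friedrichs.domain, (u : H) = J (J.adjoint x) ∧
      T.friedrichs u + u = x := by
    intro x
    have h0 : ∀ v : T.domain, inner ℂ (x - J (J.adjoint x)) (v : H)
        = inner ℂ (J (J.adjoint x)) (T v) := by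
      intro v
      have h1 := key (J.adjoint x) v
      rw [ContinuousLinearMap.adjoint_inner_left, hJ, inner_add_right] at h1
      rw [inner_sub_left, ← h1]; ring
    have hm : J (J.adjoint x) ∈ T.friedrichs.domain :=
      friedrichs_mem (by rw [hform]; exact ⟨_, rfl⟩) h0
    refine ⟨⟨_, hm⟩, rfl, ?_⟩
    refine hT.eq_of_inner_left ℂ fun v hv => ?_
    have h2 := friedrichs_inner hT ⟨_, hm⟩ ⟨v, hv⟩
    have h3 := h0 ⟨v, hv⟩
    simp only at h2 h3
    rw [inner_add_left, h2, ← h3, ← inner_add_left, sub_add_cancel]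
  -- Write `u = Jw`. By `key`, `w` is orthogonal to the dense image of `ι`; injectivity of `J` is
  -- not needed.
  have hinj : ∀ u : T.friedrichs.domain, T.friedrichs u + u = 0 → (u : H) = 0 := by
    intro u hu
    have hm : (u : H) ∈ LinearMap.range J.toLinearMap := hform ▸ u.2.1
    obtain ⟨w, hw⟩ := hm
    replace hw : J w = u := hw
    have hw0 : w = 0 := by
      refine Dense.eq_zero_of_inner_left ℂ (S := LinearMap.range ι)
        (by simpa [DenseRange, LinearMap.coe_range] using hd) ?_
      rintro _ ⟨v, rfl⟩
      rw [← key, hw, inner_add_right, ← friedrichs_inner hT, ← inner_add_left, hu, inner_zero_left]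
    rw [← hw, hw0, _root_.map_zero]
  refine ⟨J ∘L J.adjoint, ?_, ?_, hfix, fun u => ?_⟩
  · exact ContinuousLinearMap.isPositive_self_comp_adjoint J
  · calc ‖J ∘L J.adjoint‖ ≤ ‖J‖ * ‖J.adjoint‖ := ContinuousLinearMap.opNorm_comp_le _ _
      _ ≤ 1 * 1 := by
        rw [LinearIsometryEquiv.norm_map]
        gcongr
      _ = 1 := one_mul 1
  · obtain ⟨v, hv, hv'⟩ := hfix (T.friedrichs u + u)
    have h0 := hinj (v - u) (by
      rw [map_sub, Submodule.coe_sub, sub_add_sub_comm, hv', sub_self])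
    rw [Submodule.coe_sub, sub_eq_zero] at h0
    exact hv.symm.trans h0

/-- The inverse of `T_F + 1` is symmetric; substituting `(T_F + 1)u` and `(T_F + 1)v` into its
symmetry leaves that of `T_F`, up to the common term `⟨u, v⟩`. -/
theorem friedrichs_symmetric (hT : Dense (T.domain : Set H))
    (hsym : T.IsFormalAdjoint T) (hpos : ∀ u : T.domain, 0 ≤ (inner ℂ (u : H) (T u)).re) :
    T.friedrichs.IsFormalAdjoint T.friedrichs := by
  obtain ⟨A, hA, -, -, hA4⟩ := exists_friedrichs_add_one_inverse hT hsym hpos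
  intro u v
  have h := hA.isSymmetric (T.friedrichs u + u) (T.friedrichs v + v)
  simp only [ContinuousLinearMap.coe_coe, hA4, inner_add_left, inner_add_right] at h
  exact (add_right_cancel h).symm

open scoped ComplexOrder in
/-- The spectrum of the Friedrichs extension lies in `[0, ∞)`. -/
theorem exists_friedrichs_resolvent (hT : Dense (T.domain : Set H))
    (hsym : T.IsFormalAdjoint T) (hpos : ∀ u : T.domain, 0 ≤ (inner ℂ (u : H) (T u)).re)
    {lam : ℂ} (hlam : ∀ t : ℝ, 0 ≤ t → lam ≠ t) :
    ∃ R : H →L[ℂ] H,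
      (∀ x, ∃ u : T.friedrichs.domain, (u : H) = R x ∧ T.friedrichs u - lam • (u : H) = x) ∧
      ∀ u : T.friedrichs.domain, R (T.friedrichs u - lam • (u : H)) = u := by
  obtain ⟨A, hA, hA1, hA3, hA4⟩ := exists_friedrichs_add_one_inverse hT hsym hpos
  -- Otherwise `(lam + 1)⁻¹` is a spectral value `s` of `A`, necessarily in `(0, 1]`, and `lam = 1/s
  -- - 1` would be a nonnegative real.
  have hB : IsUnit (1 - (lam + 1) • A) := by
    by_cases h1 : lam + 1 = 0
    · simp [h1]
    by_contra hB
    have hmem : (lam + 1)⁻¹ ∈ spectrum ℂ A := by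
      rw [spectrum.mem_iff]
      intro hu
      apply hB
      have : 1 - (lam + 1) • A = (lam + 1) • (algebraMap ℂ (H →L[ℂ] H) (lam + 1)⁻¹ - A) := by
        rw [smul_sub, Algebra.algebraMap_eq_smul_one, smul_smul, mul_inv_cancel₀ h1, one_smul]
      rw [this]
      exact hu.smul (Units.mk0 _ h1)
    have hpos' : 0 ≤ A := (ContinuousLinearMap.nonneg_iff_isPositive A).2 hA
    have hre := hA.isSelfAdjoint.mem_spectrum_eq_re hmem
    have hnn := spectrum_nonneg_of_nonneg hpos' hmem
    have hle : ‖(lam + 1)⁻¹‖ ≤ 1 := by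
      have : Nontrivial H := by
        by_contra hn
        rw [not_nontrivial_iff_subsingleton] at hn
        exact hB (isUnit_of_subsingleton _)
      exact (spectrum.norm_le_norm_of_mem hmem).trans hA1
    obtain ⟨hn1, -⟩ := Complex.le_def.1 hnn
    rw [Complex.zero_re] at hn1
    set s : ℝ := ((lam + 1)⁻¹).re with hs
    have hs0 : 0 < s := by
      rcases hn1.eq_or_lt with h | h
      · rw [← h, Complex.ofReal_zero] at hre
        exact absurd (inv_eq_zero.1 hre) h1
      · exact h
    have hs1 : s ≤ 1 := by
      rw [hre, Complex.norm_real, Real.norm_of_nonneg hn1] at hle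
      exact hle
    have hval : lam = ((s⁻¹ - 1 : ℝ) : ℂ) := by
      have : lam + 1 = ((s : ℂ))⁻¹ := by rw [← hre, inv_inv]
      push_cast
      rw [← this]; ring
    exact hlam _ (sub_nonneg.2 ((one_le_inv₀ hs0).2 hs1)) hval
  obtain ⟨B, hB⟩ := hB
  -- The factorisation `T_F - λ = (1 - (λ + 1)A)(T_F + 1)`: both factors are invertible.
  have e : ∀ (u : T.friedrichs.domain),
      T.friedrichs u - lam • (u : H) = (B : H →L[ℂ] H) (T.friedrichs u + u) := by
    intro u
    rw [hB]
    change _ = (T.friedrichs u + u) - (lam + 1) • A (T.friedrichs u + u)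
    rw [hA4, add_smul, one_smul]
    abel
  have i1 : ∀ x, (B : H →L[ℂ] H) ((↑B⁻¹ : H →L[ℂ] H) x) = x := fun x => by
    rw [← mul_apply_eq_comp, Units.mul_inv, one_apply_eq_self]
  have i2 : ∀ x, (↑B⁻¹ : H →L[ℂ] H) ((B : H →L[ℂ] H) x) = x := fun x => by
    rw [← mul_apply_eq_comp, Units.inv_mul, one_apply_eq_self]
  refine ⟨A ∘L (↑B⁻¹ : H →L[ℂ] H), fun x => ?_, fun u => ?_⟩
  · obtain ⟨u, hu, hu'⟩ := hA3 ((↑B⁻¹ : H →L[ℂ] H) x)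
    exact ⟨u, hu, by rw [e, hu', i1]⟩
  · rw [e, ContinuousLinearMap.comp_apply, i2, hA4]

end LinearPMap

/-! ### Calculus of the Laplacian and of holomorphic maps in the plane -/

section PlaneCalculus

open Filter Topology Laplacian InnerProductSpace MeasureTheory

theorem laplacian_eq_fderiv_fderiv (f : ℂ → ℂ) (z : ℂ) :
    Laplacian.laplacian f z
      = fderiv ℝ (fderiv ℝ f) z 1 1 + fderiv ℝ (fderiv ℝ f) z Complex.I Complex.I := by
  rw [laplacian_eq_iteratedFDeriv_complexPlane]
  simp [iteratedFDeriv_two_apply]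

theorem ContDiffAt.differentiableAt_fderiv {E F : Type*} [NormedAddCommGroup E] [NormedSpace ℝ E]
    [NormedAddCommGroup F] [NormedSpace ℝ F] {f : E → F} {x : E} (hf : ContDiffAt ℝ 2 f x) :
    DifferentiableAt ℝ (fderiv ℝ f) x :=
  (hf.fderiv_right (m := 1) (by norm_num)).differentiableAt (by norm_num)

theorem fderiv_fderiv_comp {u h : ℂ → ℂ} {z : ℂ} (hu : ContDiffAt ℝ 2 u (h z))
    (hh : ContDiffAt ℝ 2 h z) (v : ℂ) :
    fderiv ℝ (fderiv ℝ (u ∘ h)) z v v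
      = fderiv ℝ (fderiv ℝ u) (h z) (fderiv ℝ h z v) (fderiv ℝ h z v)
        + fderiv ℝ u (h z) (fderiv ℝ (fderiv ℝ h) z v v) := by
  have h1 : fderiv ℝ (u ∘ h) =ᶠ[𝓝 z] fun w => (fderiv ℝ u (h w)).comp (fderiv ℝ h w) := by
    have e1 := hh.continuousAt.eventually (hu.eventually (by simp))
    filter_upwards [e1, hh.eventually (by simp)] with w hw1 hw2
    exact fderiv_comp w (hw1.differentiableAt (by norm_num)) (hw2.differentiableAt (by norm_num))
  have h2 : HasFDerivAt (fun w => fderiv ℝ u (h w)) ((fderiv ℝ (fderiv ℝ u) (h z)).comp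
      (fderiv ℝ h z)) z :=
    (hu.differentiableAt_fderiv.hasFDerivAt).comp z
      (hh.differentiableAt (by norm_num)).hasFDerivAt
  have h3 := h2.clm_comp hh.differentiableAt_fderiv.hasFDerivAt
  rw [h1.fderiv_eq, h3.fderiv]
  simp [add_comm]

/-- The Laplacian in the plane is conformally covariant. -/
theorem laplacian_comp_of_analyticAt {u h : ℂ → ℂ} {z : ℂ} (hu : ContDiffAt ℝ 2 u (h z))
    (hh : AnalyticAt ℂ h z) :
    Laplacian.laplacian (u ∘ h) z
      = ((‖deriv h z‖ ^ 2 : ℝ) : ℂ) * Laplacian.laplacian u (h z) := by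
  have hhR : ContDiffAt ℝ 2 h z := hh.contDiffAt.restrict_scalars ℝ
  have hd : ∀ v, fderiv ℝ h z v = deriv h z * v := by
    intro v
    rw [hh.differentiableAt.fderiv_restrictScalars ℝ]
    simp [mul_comm]
  -- The term of the second-order chain rule containing second derivatives of `h` disappears because
  -- `h` is harmonic.
  have hharm : Laplacian.laplacian h z = 0 := (hh.harmonicAt).2.self_of_nhds
  rw [laplacian_eq_fderiv_fderiv] at hharm ⊢
  rw [fderiv_fderiv_comp hu hhR, fderiv_fderiv_comp hu hhR, add_add_add_comm, ← map_add, hharm,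
    map_zero, add_zero, laplacian_eq_fderiv_fderiv, hd, hd]
  set B := fderiv ℝ (fderiv ℝ u) (h z)
  set a := deriv h z
  -- The cross terms of `B(a, a)` and `B(ia, ia)` cancel, leaving `|a|² (B(1, 1) + B(i, i))`.
  have e1 : a * 1 = a.re • (1 : ℂ) + a.im • Complex.I := by
    apply Complex.ext <;> simp
  have e2 : a * Complex.I = (-a.im) • (1 : ℂ) + a.re • Complex.I := by
    apply Complex.ext <;> simp
  rw [e1, e2]
  simp only [map_add, map_smul, add_apply, smul_apply]
  simp only [Complex.real_smul]
  have : ((‖a‖ ^ 2 : ℝ) : ℂ) = a.re * a.re + a.im * a.im := by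
    rw [Complex.sq_norm, Complex.normSq_apply]; push_cast; ring
  rw [this]
  push_cast
  ring

theorem fderiv_fderiv_mul {f g : ℂ → ℂ} {z : ℂ} (hf : ContDiffAt ℝ 2 f z)
    (hg : ContDiffAt ℝ 2 g z) (v : ℂ) :
    fderiv ℝ (fderiv ℝ (fun w => f w * g w)) z v v
      = fderiv ℝ (fderiv ℝ f) z v v * g z + 2 * (fderiv ℝ f z v * fderiv ℝ g z v)
        + f z * fderiv ℝ (fderiv ℝ g) z v v := by
  have h1 : fderiv ℝ (fun w => f w * g w) =ᶠ[𝓝 z]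
      fun w => f w • fderiv ℝ g w + g w • fderiv ℝ f w := by
    filter_upwards [hf.eventually (by simp), hg.eventually (by simp)] with w hw1 hw2
    exact fderiv_fun_mul (hw1.differentiableAt (by norm_num)) (hw2.differentiableAt (by norm_num))
  have f1 := (hf.differentiableAt (by norm_num)).hasFDerivAt
  have g1 := (hg.differentiableAt (by norm_num)).hasFDerivAt
  have h3 := (f1.smul hg.differentiableAt_fderiv.hasFDerivAt).add
    (g1.smul hf.differentiableAt_fderiv.hasFDerivAt)
  rw [h1.fderiv_eq]
  erw [h3.fderiv]
  simp
  ring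

/-- `Δ|φ|² = 2 Re(φ̄ Δφ) + 2 |∇φ|²`, as an inequality. -/
theorem two_mul_re_laplacian_mul_conj_le {φ : ℂ → ℂ} {z : ℂ} (hφ : ContDiffAt ℝ 2 φ z) :
    2 * (Laplacian.laplacian φ z * starRingEnd ℂ (φ z)).re
      ≤ (Laplacian.laplacian (fun w => φ w * starRingEnd ℂ (φ w)) z).re := by
  have hg : ContDiffAt ℝ 2 (fun w => starRingEnd ℂ (φ w)) z :=
    Complex.conjCLE.contDiff.contDiffAt.comp z hφ
  have hd : ∀ v, fderiv ℝ (fun w => starRingEnd ℂ (φ w)) z v = starRingEnd ℂ (fderiv ℝ φ z v) := by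
    intro v
    have : HasFDerivAt (fun w => starRingEnd ℂ (φ w))
        ((Complex.conjCLE : ℂ →L[ℝ] ℂ).comp (fderiv ℝ φ z)) z :=
      (Complex.conjCLE : ℂ →L[ℝ] ℂ).hasFDerivAt.comp z
        (hφ.differentiableAt (by norm_num)).hasFDerivAt
    rw [this.fderiv]; rfl
  have hl : Laplacian.laplacian (fun w => starRingEnd ℂ (φ w)) z
      = starRingEnd ℂ (Laplacian.laplacian φ z) :=
    hφ.laplacian_CLM_comp_left (l := (Complex.conjCLE : ℂ →L[ℝ] ℂ))
  have key : Laplacian.laplacian (fun w => φ w * starRingEnd ℂ (φ w)) z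
      = Laplacian.laplacian φ z * starRingEnd ℂ (φ z)
        + 2 * (fderiv ℝ φ z 1 * starRingEnd ℂ (fderiv ℝ φ z 1)
          + fderiv ℝ φ z Complex.I * starRingEnd ℂ (fderiv ℝ φ z Complex.I))
        + φ z * starRingEnd ℂ (Laplacian.laplacian φ z) := by
    rw [← hl, laplacian_eq_fderiv_fderiv, laplacian_eq_fderiv_fderiv,
      laplacian_eq_fderiv_fderiv (fun w => starRingEnd ℂ (φ w)), fderiv_fderiv_mul hφ hg,
      fderiv_fderiv_mul hφ hg, hd, hd]
    ring
  rw [key, Complex.mul_conj, Complex.mul_conj]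
  simp only [Complex.add_re, Complex.mul_re, Complex.conj_re, Complex.conj_im, Complex.re_ofNat,
    Complex.im_ofNat, Complex.ofReal_re, Complex.add_im, Complex.ofReal_im]
  have n1 := Complex.normSq_nonneg (fderiv ℝ φ z 1)
  have n2 := Complex.normSq_nonneg (fderiv ℝ φ z Complex.I)
  nlinarith

theorem ContDiffAt.continuousAt_laplacian {g : ℂ → ℂ} {z : ℂ} (hg : ContDiffAt ℝ 2 g z) :
    ContinuousAt (Laplacian.laplacian g) z := by
  have h := (hg.fderiv_right (m := 1) (by norm_num)).fderiv_right (m := 0) (by norm_num)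
  have h2 : ∀ v, ContinuousAt (fun x => fderiv ℝ (fderiv ℝ g) x v v) z := fun v =>
    ((h.clm_apply contDiffAt_const).clm_apply contDiffAt_const).continuousAt
  rw [funext (laplacian_eq_fderiv_fderiv g)]
  exact (h2 1).add (h2 Complex.I)

theorem integrable_mul_of_tsupport_subset {f g : ℂ → ℂ} (hf : Continuous f)
    (hfs : HasCompactSupport f) (hg : ∀ x ∈ tsupport f, ContinuousAt g x) :
    Integrable (fun x => f x * g x) := by
  refine Continuous.integrable_of_hasCompactSupport ?_ hfs.mul_right
  refine continuous_of_tsupport fun x hx => hf.continuousAt.mul (hg x ?_)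
  exact tsupport_mul_subset_left hx

/-- Green's identity in the plane. -/
theorem integral_mul_laplacian {f g : ℂ → ℂ} (hf : ContDiff ℝ 2 f) (hfs : HasCompactSupport f)
    (hg : ∀ x ∈ tsupport f, ContDiffAt ℝ 2 g x) :
    ∫ z, Laplacian.laplacian f z * g z = ∫ z, f z * Laplacian.laplacian g z := by
  have hf1 : ∀ v, ContDiff ℝ 1 (fun x => fderiv ℝ f x v) := fun v =>
    (hf.fderiv_right (m := 1) (by norm_num)).clm_apply contDiff_const
  have hf2 : ∀ v, Continuous (fun x => fderiv ℝ (fderiv ℝ f) x v v) := fun v =>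
    (((hf.fderiv_right (m := 1) (by norm_num)).continuous_fderiv (by norm_num)).clm_apply
      continuous_const).clm_apply continuous_const
  have hg1 : ∀ v, ∀ x ∈ tsupport f, ContDiffAt ℝ 1 (fun x => fderiv ℝ g x v) x := fun v x hx =>
    ((hg x hx).fderiv_right (m := 1) (by norm_num)).clm_apply contDiffAt_const
  have hg2 : ∀ v, ∀ x ∈ tsupport f, ContinuousAt (fun x => fderiv ℝ (fderiv ℝ g) x v v) x := by
    intro v x hx
    have h := ((hg x hx).fderiv_right (m := 1) (by norm_num)).fderiv_right (m := 0) (by norm_num)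
    exact ((h.clm_apply contDiffAt_const).clm_apply contDiffAt_const).continuousAt
  have hs1 : ∀ v, tsupport (fun x => fderiv ℝ f x v) ⊆ tsupport f := fun v =>
    (closure_mono fun x hx => by
      simp only [Function.mem_support] at hx ⊢
      intro h0; rw [h0] at hx; simp at hx).trans (tsupport_fderiv_subset ℝ (f := f))
  have hs2 : ∀ v, tsupport (fun x => fderiv ℝ (fderiv ℝ f) x v v) ⊆ tsupport f := fun v =>
    ((closure_mono fun x hx => by
      simp only [Function.mem_support] at hx ⊢
      intro h0; rw [h0] at hx; simp at hx).trans
        (tsupport_fderiv_subset ℝ (f := fderiv ℝ f))).trans (tsupport_fderiv_subset ℝ (f := f))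
  have hc1 : ∀ v, HasCompactSupport (fun x => fderiv ℝ f x v) := fun v =>
    hfs.of_isClosed_subset (isClosed_tsupport _) (hs1 v)
  have hc2 : ∀ v, HasCompactSupport (fun x => fderiv ℝ (fderiv ℝ f) x v v) := fun v =>
    hfs.of_isClosed_subset (isClosed_tsupport _) (hs2 v)
  have i1 : ∀ v, Integrable (fun x => fderiv ℝ (fderiv ℝ f) x v v * g x) := fun v =>
    integrable_mul_of_tsupport_subset (hf2 v) (hc2 v) fun x hx =>
      (hg x (hs2 v hx)).continuousAt
  have i2 : ∀ v, Integrable (fun x => f x * fderiv ℝ (fderiv ℝ g) x v v) := fun v =>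
    integrable_mul_of_tsupport_subset hf.continuous hfs (hg2 v)
  have i3 : ∀ v, Integrable (fun x => fderiv ℝ f x v * fderiv ℝ g x v) := fun v =>
    integrable_mul_of_tsupport_subset (hf1 v).continuous (hc1 v) fun x hx =>
      (hg1 v x (hs1 v hx)).continuousAt
  have e1 : ∀ v x, x ∈ tsupport f →
      fderiv ℝ (fun x => fderiv ℝ g x v) x v = fderiv ℝ (fderiv ℝ g) x v v := by
    intro v x hx
    rw [fderiv_clm_apply (hg x hx).differentiableAt_fderiv (differentiableAt_const v)]
    simp
  have e2 : ∀ v x, fderiv ℝ (fun x => fderiv ℝ f x v) x v = fderiv ℝ (fderiv ℝ f) x v v := by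
    intro v x
    rw [fderiv_clm_apply hf.contDiffAt.differentiableAt_fderiv (differentiableAt_const v)]
    simp
  have e1' : ∀ v, (fun x => f x * fderiv ℝ (fun x => fderiv ℝ g x v) x v)
      = fun x => f x * fderiv ℝ (fderiv ℝ g) x v v := by
    intro v
    ext x
    by_cases hx : x ∈ tsupport f
    · rw [e1 v x hx]
    · simp [image_eq_zero_of_notMem_tsupport hx]
  -- Two integrations by parts meet at `-∫ ∂ᵥf ∂ᵥg`. There are no boundary terms since every product
  -- is supported in `tsupport f`, the only place where `g` has to be regular.
  have key : ∀ v, ∫ x, fderiv ℝ (fderiv ℝ f) x v v * g x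
      = ∫ x, f x * fderiv ℝ (fderiv ℝ g) x v v := by
    intro v
    have a1 := integral_mul_fderiv_eq_neg_fderiv_mul_of_integrable (μ := volume) (f := f)
      (g := fun x => fderiv ℝ g x v) (v := v) (i3 v) (by rw [e1']; exact i2 v)
      (integrable_mul_of_tsupport_subset hf.continuous hfs fun x hx => (hg1 v x hx).continuousAt)
      (fun x _ => hf.differentiable (by norm_num) x)
      (fun x hx => (hg1 v x hx).differentiableAt (by norm_num))
    have a2 := integral_mul_fderiv_eq_neg_fderiv_mul_of_integrable (μ := volume)
      (f := fun x => fderiv ℝ f x v) (g := g) (v := v) (by simpa only [e2] using i1 v) (i3 v)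
      (integrable_mul_of_tsupport_subset (hf1 v).continuous (hc1 v) fun x hx =>
        (hg x (hs1 v hx)).continuousAt)
      (fun x _ => (hf1 v).differentiable (by norm_num) x)
      (fun x hx => (hg x (hs1 v hx)).differentiableAt (by norm_num))
    rw [e1'] at a1
    simp only [e2] at a2
    rw [a1, a2, neg_neg]
  simp only [laplacian_eq_fderiv_fderiv, add_mul, mul_add]
  rw [integral_add (i1 _) (i1 _), integral_add (i2 _) (i2 _), key, key]

/-- In polar coordinates the integrand becomes `y ^ (s + 1)`. It serves both for the finiteness of
the area (`s = 2b`) and for the square integrability of the singular functions. -/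
theorem integrableOn_norm_rpow_ball {s : ℝ} (hs : -2 < s) (r : ℝ) :
    IntegrableOn (fun z : ℂ => ‖z‖ ^ s) (Metric.ball 0 r) := by
  rw [integrableOn_fun_norm_addHaar (μ := volume) (f := fun y : ℝ => y ^ s)]
  have h : IntegrableOn (fun y : ℝ => y ^ (s + 1)) (Set.Ioo 0 r) := by
    rcases le_or_gt r 0 with hr | hr
    · simp [Set.Ioo_eq_empty hr.not_gt]
    · exact (intervalIntegral.integrableOn_Ioo_rpow_iff hr).2 (by linarith)
  refine h.congr_fun (fun y hy => ?_) measurableSet_Ioo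
  simp [Real.rpow_add hy.1, mul_comm]

/-- The real derivative is multiplication by `h'(z)`, whose determinant is the norm of `ℂ` over `ℝ`.
This is the Jacobian when the parameter is changed. -/
theorem abs_det_fderiv_of_differentiableAt {h : ℂ → ℂ} {z : ℂ} (hh : DifferentiableAt ℂ h z) :
    |(fderiv ℝ h z).det| = ‖deriv h z‖ ^ 2 := by
  have h1 : ((fderiv ℝ h z : ℂ →L[ℝ] ℂ) : ℂ →ₗ[ℝ] ℂ) = LinearMap.mulLeft ℝ (deriv h z) := by
    ext; simp [hh.fderiv_restrictScalars ℝ, mul_comm]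
  rw [ContinuousLinearMap.det, h1]
  have h2 := Algebra.norm_complex_apply (deriv h z)
  rw [Algebra.norm_apply] at h2
  rw [show LinearMap.mulLeft ℝ (deriv h z) = Algebra.lmul ℝ ℂ (deriv h z) from rfl, h2,
    Complex.normSq_eq_norm_sq, abs_of_nonneg (sq_nonneg _)]

end PlaneCalculus

/-! ### Smoothness and the Laplacian in the distinguished parameters -/

theorem contDiffGroupoid_complex_le_real :
    contDiffGroupoid ω 𝓘(ℂ) ≤ contDiffGroupoid ∞ 𝓘(ℝ, ℂ) := by
  intro e he
  simp only [contDiffGroupoid, contDiffPregroupoid] at he ⊢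
  exact ⟨(he.1.restrict_scalars ℝ).of_le le_top, (he.2.restrict_scalars ℝ).of_le le_top⟩

/-- The smooth surface underlying a Riemann surface. -/
instance isManifold_real_of_complex {X : Type*} [TopologicalSpace X] [ChartedSpace ℂ X]
    [h : IsManifold 𝓘(ℂ) ω X] : IsManifold 𝓘(ℝ, ℂ) ∞ X :=
  { hasGroupoid_of_le h.toHasGroupoid contDiffGroupoid_complex_le_real with }

namespace FlatConicalMetric

open Filter Topology

variable {X : Type*} [TopologicalSpace X] [ChartedSpace ℂ X] [IsManifold 𝓘(ℂ) ω X]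
  (m : FlatConicalMetric X)

theorem chart_mem_real (p : X) : m.chart p ∈ IsManifold.maximalAtlas 𝓘(ℝ, ℂ) ∞ X :=
  StructureGroupoid.maximalAtlas_mono contDiffGroupoid_complex_le_real (m.chart_mem p)

theorem contMDiffAt_chart {p x : X} (hx : x ∈ (m.chart p).source) :
    ContMDiffAt 𝓘(ℝ, ℂ) 𝓘(ℝ, ℂ) ∞ (m.chart p) x :=
  contMDiffAt_of_mem_maximalAtlas (m.chart_mem_real p) hx

theorem contMDiffAt_chart_symm {p : X} {z : ℂ} (hz : z ∈ (m.chart p).target) :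
    ContMDiffAt 𝓘(ℝ, ℂ) 𝓘(ℝ, ℂ) ∞ (m.chart p).symm z :=
  contMDiffAt_symm_of_mem_maximalAtlas (m.chart_mem_real p) hz

theorem contDiffAt_comp_chart_symm {n : WithTop ℕ∞} [hn : ENat.LEInfty n] {f : X → ℂ} {p x : X} (hx : x ∈ (m.chart p).source)
    (hf : ContMDiffAt 𝓘(ℝ, ℂ) 𝓘(ℝ, ℂ) n f x) :
    ContDiffAt ℝ n (f ∘ (m.chart p).symm) (m.chart p x) := by
  have h := m.contMDiffAt_chart_symm ((m.chart p).map_source hx)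
  rw [← (m.chart p).left_inv hx] at hf
  exact (hf.comp _ (h.of_le hn.out)).contDiffAt

theorem contMDiffAt_of_comp_chart_symm {n : WithTop ℕ∞} [hn : ENat.LEInfty n] {f : X → ℂ} {p x : X} (hx : x ∈ (m.chart p).source)
    (hf : ContDiffAt ℝ n (f ∘ (m.chart p).symm) (m.chart p x)) :
    ContMDiffAt 𝓘(ℝ, ℂ) 𝓘(ℝ, ℂ) n f x := by
  refine (hf.contMDiffAt.comp x ((m.contMDiffAt_chart hx).of_le hn.out)).congr_of_eventuallyEq ?_
  filter_upwards [(m.chart p).open_source.mem_nhds hx] with y hy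
  simp [(m.chart p).left_inv hy]

theorem isTest_iff {φ : X → ℂ} :
    m.IsTest φ ↔ ContMDiff 𝓘(ℝ, ℂ) 𝓘(ℝ, ℂ) ∞ φ ∧ tsupport φ ⊆ {x | m.exponent x = 0} := by
  refine and_congr_left fun _ => ⟨fun h x => ?_, fun h p z hz => ?_⟩
  · exact m.contMDiffAt_of_comp_chart_symm (m.mem_source x)
      ((h x).contDiffAt ((m.chart x).open_target.mem_nhds
        ((m.chart x).map_source (m.mem_source x))))
  · have := m.contDiffAt_comp_chart_symm ((m.chart p).map_target hz) (h ((m.chart p).symm z))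
    rw [(m.chart p).right_inv hz] at this
    exact this.contDiffWithinAt

theorem analyticAt_transition {p q x : X} (hp : x ∈ (m.chart p).source)
    (hq : x ∈ (m.chart q).source) :
    AnalyticAt ℂ (m.chart q ∘ (m.chart p).symm) (m.chart p x) := by
  have h1 : ContMDiffAt 𝓘(ℂ) 𝓘(ℂ) ω (m.chart p).symm (m.chart p x) :=
    contMDiffAt_symm_of_mem_maximalAtlas (m.chart_mem p) ((m.chart p).map_source hp)
  have h2 : ContMDiffAt 𝓘(ℂ) 𝓘(ℂ) ω (m.chart q) ((m.chart p).symm (m.chart p x)) := by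
    rw [(m.chart p).left_inv hp]
    exact contMDiffAt_of_mem_maximalAtlas (m.chart_mem q) hq
  exact (h2.comp _ h1).contDiffAt.analyticAt

theorem chart_ne_zero {p x : X} (hx : x ∈ (m.chart p).source) (hne : x ≠ p) :
    m.chart p x ≠ 0 := fun h =>
  hne ((m.chart p).injOn hx (m.mem_source p) (h.trans (m.chart_self p).symm))

/-- The conical points are isolated. -/
theorem exponent_eq_zero {p x : X} (hx : x ∈ (m.chart p).source) (hne : x ≠ p) :
    m.exponent x = 0 := by
  by_contra h
  -- Compare the parameters of `p` and `x` at `x` itself. If `b_x ≠ 0`, the left side is `0`, also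
  -- for negative `b_x` by the convention `0 ^ s = 0` of `Real.rpow`; the right side is positive.
  have h1 := m.compatible p x x ⟨hx, m.mem_source x⟩
  rw [m.chart_self x, norm_zero, Real.zero_rpow (mul_ne_zero two_ne_zero h), zero_mul] at h1
  exact (Real.rpow_pos_of_pos (norm_pos_iff.2 (m.chart_ne_zero hx hne)) _).ne h1

theorem isOpen_smooth : IsOpen {x | m.exponent x = 0} := by
  rw [isOpen_iff_mem_nhds]
  intro p hp
  filter_upwards [(m.chart p).open_source.mem_nhds (m.mem_source p)] with x hx
  by_cases h : x = p
  · rw [h]; exact hp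
  · exact m.exponent_eq_zero hx h

theorem norm_rpow_pos {p x : X} (hx : x ∈ (m.chart p).source) (h0 : m.exponent x = 0) :
    0 < ‖m.chart p x‖ ^ (2 * m.exponent p) := by
  by_cases h : x = p
  · rw [← h, h0, mul_zero, Real.rpow_zero]; exact one_pos
  · exact Real.rpow_pos_of_pos (norm_pos_iff.2 (m.chart_ne_zero hx h)) _

/-- The Laplacian in a distinguished parameter. -/
theorem laplacian_chart {φ : X → ℂ} {p x : X} (hx : x ∈ (m.chart p).source)
    (h0 : m.exponent x = 0) (hφ : ContMDiffAt 𝓘(ℝ, ℂ) 𝓘(ℝ, ℂ) 2 φ x) :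
    ((‖m.chart p x‖ ^ (2 * m.exponent p) : ℝ) : ℂ) * m.laplacian φ x
      = -Laplacian.laplacian (φ ∘ (m.chart p).symm) (m.chart p x) := by
  have hxx := m.mem_source x
  -- At a smooth point this says that `|h'|²`, for the transition map `h` from the parameter of `p`
  -- to that of `x`, is the conformal factor at `p`.
  have hc := m.compatible p x x ⟨hx, hxx⟩
  rw [h0, mul_zero, Real.rpow_zero, one_mul] at hc
  have hval : (m.chart x ∘ (m.chart p).symm) (m.chart p x) = 0 := by
    simp [(m.chart p).left_inv hx, m.chart_self x]
  have hu : ContDiffAt ℝ 2 (φ ∘ (m.chart x).symm) ((m.chart x ∘ (m.chart p).symm) (m.chart p x)) := by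
    rw [hval, ← m.chart_self x]
    exact m.contDiffAt_comp_chart_symm hxx hφ
  have hcomp := laplacian_comp_of_analyticAt hu (m.analyticAt_transition hx hxx)
  have hev : (φ ∘ (m.chart x).symm) ∘ (m.chart x ∘ (m.chart p).symm)
      =ᶠ[𝓝 (m.chart p x)] φ ∘ (m.chart p).symm := by
    have hcont := (m.chart p).continuousAt_symm ((m.chart p).map_source hx)
    have : ∀ᶠ z in 𝓝 (m.chart p x), (m.chart p).symm z ∈ (m.chart x).source := by
      refine hcont.eventually_mem ?_
      rw [(m.chart p).left_inv hx]
      exact (m.chart x).open_source.mem_nhds hxx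
    filter_upwards [this] with z hz
    simp [(m.chart x).left_inv hz]
  rw [(InnerProductSpace.laplacian_congr_nhds hev).eq_of_nhds, hval, hc] at hcomp
  rw [hcomp, laplacian, mul_neg]

theorem laplacian_congr {φ ψ : X → ℂ} {x : X} (h : φ =ᶠ[𝓝 x] ψ) :
    m.laplacian φ x = m.laplacian ψ x := by
  rw [laplacian, laplacian]
  congr 1
  refine (InnerProductSpace.laplacian_congr_nhds (f₁ := φ ∘ (m.chart x).symm)
    (f₂ := ψ ∘ (m.chart x).symm) ?_).eq_of_nhds
  have hcont := (m.chart x).continuousAt_symm ((m.chart x).map_source (m.mem_source x))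
  rw [m.chart_self] at hcont
  have h' : ∀ᶠ y in 𝓝 ((m.chart x).symm 0), φ y = ψ y := by
    rw [← m.chart_self x, (m.chart x).left_inv (m.mem_source x)]
    exact h
  exact hcont.eventually h'

theorem laplacian_eq_zero_of_notMem_tsupport {φ : X → ℂ} {x : X} (hx : x ∉ tsupport φ) :
    m.laplacian φ x = 0 := by
  rw [m.laplacian_congr (notMem_tsupport_iff_eventuallyEq.1 hx), laplacian]
  have : (0 : X → ℂ) ∘ (m.chart x).symm = fun _ => 0 := rfl
  rw [this, InnerProductSpace.laplacian_const]
  simp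

theorem contDiffAt_two_at_zero {φ : X → ℂ} {x : X} (hφ : ContMDiffAt 𝓘(ℝ, ℂ) 𝓘(ℝ, ℂ) 2 φ x) :
    ContDiffAt ℝ 2 (φ ∘ (m.chart x).symm) 0 := by
  rw [← m.chart_self x]
  exact m.contDiffAt_comp_chart_symm (m.mem_source x) hφ

theorem laplacian_add {φ ψ : X → ℂ} {x : X} (hφ : ContMDiffAt 𝓘(ℝ, ℂ) 𝓘(ℝ, ℂ) 2 φ x)
    (hψ : ContMDiffAt 𝓘(ℝ, ℂ) 𝓘(ℝ, ℂ) 2 ψ x) :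
    m.laplacian (φ + ψ) x = m.laplacian φ x + m.laplacian ψ x := by
  rw [laplacian, laplacian, laplacian, ← neg_add,
    ← (m.contDiffAt_two_at_zero hφ).laplacian_add (m.contDiffAt_two_at_zero hψ)]
  rfl

theorem laplacian_smul (c : ℂ) {φ : X → ℂ} {x : X} (hφ : ContMDiffAt 𝓘(ℝ, ℂ) 𝓘(ℝ, ℂ) 2 φ x) :
    m.laplacian (c • φ) x = c * m.laplacian φ x := by
  have := (m.contDiffAt_two_at_zero hφ).laplacian_CLM_comp_left
    (l := ContinuousLinearMap.mul ℝ ℂ c)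
  rw [laplacian, laplacian, mul_neg]
  congr 1

theorem laplacian_conj {φ : X → ℂ} {x : X} (hφ : ContMDiffAt 𝓘(ℝ, ℂ) 𝓘(ℝ, ℂ) 2 φ x) :
    m.laplacian (fun y => starRingEnd ℂ (φ y)) x = starRingEnd ℂ (m.laplacian φ x) := by
  have := (m.contDiffAt_two_at_zero hφ).laplacian_CLM_comp_left
    (l := (Complex.conjCLE : ℂ →L[ℝ] ℂ))
  rw [laplacian, laplacian, map_neg]
  congr 1

theorem laplacian_sum {ι : Type*} (s : Finset ι) {φ : ι → X → ℂ} {x : X}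
    (hφ : ∀ i ∈ s, ContMDiffAt 𝓘(ℝ, ℂ) 𝓘(ℝ, ℂ) 2 (φ i) x) :
    m.laplacian (∑ i ∈ s, φ i) x = ∑ i ∈ s, m.laplacian (φ i) x := by
  classical
  induction s using Finset.induction_on with
  | empty =>
    have : (0 : X → ℂ) ∘ (m.chart x).symm = fun _ => 0 := rfl
    rw [Finset.sum_empty, Finset.sum_empty, laplacian, this, InnerProductSpace.laplacian_const]
    simp
  | insert i s hi ih =>
    have h2 : ∀ j ∈ s, ContMDiffAt 𝓘(ℝ, ℂ) 𝓘(ℝ, ℂ) 2 (φ j) x := fun j hj =>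
      hφ j (Finset.mem_insert_of_mem hj)
    have h3 : ContMDiffAt 𝓘(ℝ, ℂ) 𝓘(ℝ, ℂ) 2 (∑ j ∈ s, φ j) x := by
      have := contMDiffAt_finsetSum h2
      convert! this using 1
      ext y
      simp
    rw [Finset.sum_insert hi, Finset.sum_insert hi,
      m.laplacian_add (hφ i (Finset.mem_insert_self _ _)) h3, ih h2]

/-- The value at each `y` is computed in the parameter of `y`, which varies. Near a smooth point
`x`, `laplacian_chart` expresses all these values in the fixed parameter of `x`, where the conformal
factor is `1`. -/
theorem continuousAt_laplacian {φ : X → ℂ} {x : X} (h0 : m.exponent x = 0)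
    (hφ : ContMDiffAt 𝓘(ℝ, ℂ) 𝓘(ℝ, ℂ) 2 φ x) : ContinuousAt (m.laplacian φ) x := by
  have hxx := m.mem_source x
  have hev := (m.contDiffAt_comp_chart_symm hxx hφ).eventually (by simp)
  have h1 : ∀ᶠ y in 𝓝 x, m.laplacian φ y
      = -Laplacian.laplacian (φ ∘ (m.chart x).symm) (m.chart x y) := by
    filter_upwards [((m.chart x).continuousAt hxx).eventually hev,
      (m.chart x).open_source.mem_nhds hxx, m.isOpen_smooth.mem_nhds h0] with y hy1 hy2 hy3
    have := m.laplacian_chart hy2 hy3 (m.contMDiffAt_of_comp_chart_symm hy2 hy1)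
    rwa [h0, mul_zero, Real.rpow_zero, Complex.ofReal_one, one_mul] at this
  have h3 := (m.contDiffAt_comp_chart_symm hxx hφ).continuousAt_laplacian
  have h4 : ContinuousAt (fun y => -Laplacian.laplacian (φ ∘ (m.chart x).symm) (m.chart x y)) x :=
    (ContinuousAt.comp h3 ((m.chart x).continuousAt hxx)).neg
  exact h4.congr (h1.mono fun y hy => hy.symm)

end FlatConicalMetric

/-! ### The area measure and its local expressions -/

namespace MeasureTheory.Measure

/-- Measures on the members of a countable cover which agree on overlaps are the restrictions of
their supremum. -/
theorem iSup_restrict_of_compatible {X ι : Type*} [MeasurableSpace X] {U : ι → Set X}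
    {μ : ι → Measure X} (hU : ∀ i, MeasurableSet (U i)) (hμ : ∀ i, (μ i).restrict (U i) = μ i)
    (hov : ∀ i j, (μ i).restrict (U i ∩ U j) = (μ j).restrict (U i ∩ U j))
    (e : ℕ → ι) (he : ⋃ n, U (e n) = Set.univ) (i : ι) :
    (⨆ j, μ j).restrict (U i) = μ i := by
  -- Disjoint pieces of the cover allow the local measures to be added without counting overlaps
  -- twice; the glued measure `A` turns out to be the supremum.
  set D : ℕ → Set X := disjointed fun n => U (e n) with hD
  have hDm : ∀ n, MeasurableSet (D n) := MeasurableSet.disjointed fun n => hU (e n)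
  have hDd : Pairwise (Function.onFun Disjoint D) := disjoint_disjointed _
  have hDu : ⋃ n, D n = Set.univ := (iUnion_disjointed).trans he
  have hDs : ∀ n, D n ⊆ U (e n) := disjointed_subset _
  have hsum : ∀ ν : Measure X, sum (fun n => ν.restrict (D n)) = ν := fun ν => by
    rw [← restrict_iUnion hDd hDm, hDu, restrict_univ]
  set A : Measure X := sum fun n => (μ (e n)).restrict (D n) with hA
  have hres : ∀ j, A.restrict (U j) = μ j := by
    intro j
    rw [hA, restrict_sum _ (hU j)]
    have : ∀ n, ((μ (e n)).restrict (D n)).restrict (U j) = (μ j).restrict (D n) := by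
      intro n
      rw [restrict_restrict (hU j), ← hμ j, restrict_restrict (hDm n), Set.inter_comm]
      have hs : D n ∩ U j ⊆ U (e n) ∩ U j := Set.inter_subset_inter_left _ (hDs n)
      have h1 := congrArg (fun ν : Measure X => ν.restrict (D n ∩ U j)) (hov (e n) j)
      simpa only [restrict_restrict ((hDm n).inter (hU j)),
        Set.inter_eq_self_of_subset_left hs] using h1
    rw [funext this, hsum]
  have hsup : ⨆ j, μ j = A := by
    refine le_antisymm (iSup_le fun j => ?_) ?_
    · rw [← hres j]; exact restrict_le_self
    · rw [← hsum (⨆ j, μ j), hA]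
      refine le_iff.2 fun s hs => ?_
      rw [sum_apply _ hs, sum_apply _ hs]
      exact ENNReal.tsum_le_tsum fun n => restrict_mono subset_rfl (le_iSup μ (e n)) s
  rw [hsup, hres]

end MeasureTheory.Measure

namespace FlatConicalMetric

open Filter Topology MeasureTheory

variable {X : Type*} [TopologicalSpace X] [ChartedSpace ℂ X] [IsManifold 𝓘(ℂ) ω X]
  [MeasurableSpace X] [BorelSpace X] (m : FlatConicalMetric X)

/-- The area of the metric in the domain of the distinguished parameter at `p`, as a measure on the
plane. -/
noncomputable def planeArea (p : X) : Measure ℂ :=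
  (volume.restrict (m.chart p).target).withDensity
    fun z => ENNReal.ofReal (‖z‖ ^ (2 * m.exponent p))

omit [BorelSpace X] in
theorem localArea_eq_map (p : X) : m.localArea p = (m.planeArea p).map (m.chart p).symm := rfl

theorem measurable_norm_rpow (s : ℝ) : Measurable fun z : ℂ => ‖z‖ ^ s :=
  measurable_norm.pow_const s

theorem aemeasurable_chart_symm (p : X) : AEMeasurable (m.chart p).symm (m.planeArea p) :=
  ((m.chart p).continuousOn_symm.aemeasurable
    (m.chart p).open_target.measurableSet).mono_ac (withDensity_absolutelyContinuous _ _)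

theorem measurableSet_target_inter_preimage (p : X) {s : Set X} (hs : MeasurableSet s) :
    MeasurableSet ((m.chart p).target ∩ (m.chart p).symm ⁻¹' s) := by
  classical
  have h : Measurable ((m.chart p).target.piecewise (m.chart p).symm fun _ => p) :=
    (m.chart p).continuousOn_symm.measurable_piecewise continuousOn_const
      (m.chart p).open_target.measurableSet
  convert! (m.chart p).open_target.measurableSet.inter (h hs) using 1
  ext z
  simp only [Set.mem_inter_iff, Set.mem_preimage]
  refine and_congr_right fun hz => ?_
  rw [Set.piecewise_eq_of_mem _ _ _ hz]

theorem localArea_apply (p : X) {s : Set X} (hs : MeasurableSet s) :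
    m.localArea p s = ∫⁻ z in (m.chart p).target ∩ (m.chart p).symm ⁻¹' s,
      ENNReal.ofReal (‖z‖ ^ (2 * m.exponent p)) := by
  have hm := m.measurableSet_target_inter_preimage p hs
  rw [localArea_eq_map, Measure.map_apply_of_aemeasurable (m.aemeasurable_chart_symm p) hs]
  have h0 : m.planeArea p (m.chart p).targetᶜ = 0 := by
    refine withDensity_absolutelyContinuous _ _ ?_
    rw [Measure.restrict_apply (m.chart p).open_target.measurableSet.compl, Set.compl_inter_self,
      measure_empty]
  have h1 : m.planeArea p ((m.chart p).symm ⁻¹' s)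
      = m.planeArea p ((m.chart p).target ∩ (m.chart p).symm ⁻¹' s) := by
    refine le_antisymm ?_ (measure_mono Set.inter_subset_right)
    refine (measure_mono (t := ((m.chart p).target ∩ (m.chart p).symm ⁻¹' s)
      ∪ (m.chart p).targetᶜ) fun z hz => ?_).trans ((measure_union_le _ _).trans_eq ?_)
    · by_cases h : z ∈ (m.chart p).target
      · exact Or.inl ⟨h, hz⟩
      · exact Or.inr h
    · rw [h0, add_zero]
  rw [h1, planeArea, withDensity_apply _ hm, Measure.restrict_restrict hm,
    Set.inter_eq_self_of_subset_left Set.inter_subset_left]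

/-- Change of variables along the transition map: its Jacobian `|h'|²` is the quotient of the two
densities, by `compatible`. -/
theorem localArea_eq_of_subset (p q : X) {s : Set X} (hs : MeasurableSet s)
    (hp : s ⊆ (m.chart p).source) (hq : s ⊆ (m.chart q).source) :
    m.localArea p s = m.localArea q s := by
  rw [m.localArea_apply p hs, m.localArea_apply q hs]
  set A := (m.chart p).target ∩ (m.chart p).symm ⁻¹' s with hA
  set B := (m.chart q).target ∩ (m.chart q).symm ⁻¹' s with hB
  set h := m.chart q ∘ (m.chart p).symm with hh
  have hAm : MeasurableSet A := m.measurableSet_target_inter_preimage p hs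
  have hAB : B = h '' A := by
    ext w
    constructor
    · rintro ⟨hw1, hw2⟩
      refine ⟨m.chart p ((m.chart q).symm w), ⟨(m.chart p).map_source (hp hw2), ?_⟩, ?_⟩
      · rwa [Set.mem_preimage, (m.chart p).left_inv (hp hw2)]
      · simp [hh, (m.chart p).left_inv (hp hw2), (m.chart q).right_inv hw1]
    · rintro ⟨z, ⟨hz1, hz2⟩, rfl⟩
      refine ⟨(m.chart q).map_source (hq hz2), ?_⟩
      rw [Set.mem_preimage, hh, Function.comp_apply, (m.chart q).left_inv (hq hz2)]
      exact hz2
  have hd : ∀ z ∈ A, DifferentiableAt ℂ h z := by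
    rintro z ⟨hz1, hz2⟩
    have := m.analyticAt_transition (hp hz2) (hq hz2)
    rw [(m.chart p).right_inv hz1] at this
    exact this.differentiableAt
  have hinj : Set.InjOn h A := by
    rintro z ⟨hz1, hz2⟩ w ⟨hw1, hw2⟩ hzw
    exact (m.chart p).symm.injOn hz1 hw1 ((m.chart q).injOn (hq hz2) (hq hw2) hzw)
  rw [hAB, lintegral_image_eq_lintegral_abs_det_fderiv_mul volume hAm
    (fun z hz => ((hd z hz).restrictScalars ℝ).hasFDerivAt.hasFDerivWithinAt) hinj]
  refine setLIntegral_congr_fun hAm fun z hz => ?_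
  have hc := m.compatible p q ((m.chart p).symm z) ⟨hp hz.2, hq hz.2⟩
  rw [(m.chart p).right_inv hz.1] at hc
  rw [abs_det_fderiv_of_differentiableAt (hd z hz), ← ENNReal.ofReal_mul (sq_nonneg _), ← hc,
    mul_comm]
  rfl

theorem localArea_restrict_source (p : X) :
    (m.localArea p).restrict (m.chart p).source = m.localArea p := by
  have hs := (m.chart p).open_source.measurableSet
  refine Measure.restrict_eq_self_of_ae_mem (mem_ae_iff.2 ?_)
  have h0 : (m.chart p).target ∩ (m.chart p).symm ⁻¹' (m.chart p).sourceᶜ = ∅ :=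
    Set.eq_empty_of_forall_notMem fun z hz => hz.2 ((m.chart p).map_target hz.1)
  change m.localArea p (m.chart p).sourceᶜ = 0
  rw [m.localArea_apply p hs.compl, h0, Measure.restrict_empty, lintegral_zero_measure]

omit [MeasurableSpace X] [BorelSpace X] in
theorem exists_countable_cover [CompactSpace X] [Nonempty X] :
    ∃ e : ℕ → X, ⋃ n, (m.chart (e n)).source = Set.univ := by
  obtain ⟨t, ht⟩ := isCompact_univ.elim_finite_subcover (fun p : X => (m.chart p).source)
    (fun p => (m.chart p).open_source) fun p _ => Set.mem_iUnion.2 ⟨p, m.mem_source p⟩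
  have hne : (t : Set X).Nonempty := by
    obtain ⟨x⟩ := ‹Nonempty X›
    obtain ⟨p, hp, -⟩ := Set.mem_iUnion₂.1 (ht (Set.mem_univ x))
    exact ⟨p, hp⟩
  obtain ⟨e, he⟩ := t.countable_toSet.exists_eq_range hne
  refine ⟨e, Set.eq_univ_of_univ_subset fun x hx => ?_⟩
  obtain ⟨p, hp, hxp⟩ := Set.mem_iUnion₂.1 (ht hx)
  obtain ⟨n, rfl⟩ : p ∈ Set.range e := he ▸ hp
  exact Set.mem_iUnion.2 ⟨n, hxp⟩

/-- The area measure restricts to the local area measures. -/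
theorem area_restrict_source [CompactSpace X] (p : X) :
    m.area.restrict (m.chart p).source = m.localArea p := by
  have : Nonempty X := ⟨p⟩
  obtain ⟨e, he⟩ := m.exists_countable_cover
  refine Measure.iSup_restrict_of_compatible (fun i => (m.chart i).open_source.measurableSet)
    m.localArea_restrict_source (fun i j => ?_) e he p
  ext s hs
  have hm := (m.chart i).open_source.measurableSet.inter (m.chart j).open_source.measurableSet
  rw [Measure.restrict_apply hs, Measure.restrict_apply hs]
  exact m.localArea_eq_of_subset i j (hs.inter hm)
    (Set.inter_subset_right.trans Set.inter_subset_left)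
    (Set.inter_subset_right.trans Set.inter_subset_right)

/-- Near `p` the area is the integral of `|z|^(2b)` over a disc, finite because `2b > -2`;
compactness leaves finitely many discs. -/
instance [CompactSpace X] : IsFiniteMeasure m.area := by
  have hloc : ∀ p : X, ∃ U ∈ 𝓝 p, m.area U < ⊤ := by
    intro p
    obtain ⟨r, hr, hrs⟩ := Metric.isOpen_iff.1 (m.chart p).open_target 0
      (by rw [← m.chart_self p]; exact (m.chart p).map_source (m.mem_source p))
    set U := (m.chart p).source ∩ m.chart p ⁻¹' Metric.ball 0 r with hU
    have hUo : IsOpen U := (m.chart p).isOpen_inter_preimage Metric.isOpen_ball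
    refine ⟨U, hUo.mem_nhds ⟨m.mem_source p, by simp [m.chart_self, hr]⟩, ?_⟩
    have h1 : m.area U = m.localArea p U := by
      rw [← m.area_restrict_source p, Measure.restrict_apply hUo.measurableSet,
        Set.inter_eq_self_of_subset_left Set.inter_subset_left]
    rw [h1, m.localArea_apply p hUo.measurableSet]
    have h2 : (m.chart p).target ∩ (m.chart p).symm ⁻¹' U ⊆ Metric.ball 0 r := by
      rintro z ⟨hz1, -, hz2⟩
      rwa [Set.mem_preimage, (m.chart p).right_inv hz1] at hz2
    refine (lintegral_mono_set h2).trans_lt ?_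
    have h3 := integrableOn_norm_rpow_ball (s := 2 * m.exponent p)
      (by linarith [m.exponent_gt p]) r
    exact h3.lintegral_lt_top
  choose U hU hUf using hloc
  obtain ⟨t, -, ht⟩ := isCompact_univ.elim_nhds_subcover U fun x _ => hU x
  refine ⟨(measure_mono ht).trans_lt ?_⟩
  exact (measure_biUnion_lt_top t.finite_toSet fun p _ => hUf p)

omit [MeasurableSpace X] [BorelSpace X] in
theorem ae_mem_target (p : X) : ∀ᵐ z ∂m.planeArea p, z ∈ (m.chart p).target :=
  withDensity_absolutelyContinuous _ _
    (ae_restrict_mem (m.chart p).open_target.measurableSet)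

theorem integral_area_eq_planeArea [CompactSpace X] {f : X → ℂ}
    (hf : AEStronglyMeasurable f m.area) (p : X) (h0 : ∀ x ∉ (m.chart p).source, f x = 0) :
    ∫ x, f x ∂m.area = ∫ z, f ((m.chart p).symm z) ∂m.planeArea p := by
  rw [← setIntegral_eq_integral_of_forall_compl_eq_zero h0, m.area_restrict_source p,
    localArea_eq_map, integral_map (m.aemeasurable_chart_symm p)]
  rw [← localArea_eq_map, ← m.area_restrict_source p]
  exact hf.restrict

theorem integral_area [CompactSpace X] {f : X → ℂ} (hf : AEStronglyMeasurable f m.area) (p : X)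
    (h0 : ∀ x ∉ (m.chart p).source, f x = 0) :
    ∫ x, f x ∂m.area = ∫ z in (m.chart p).target,
      ((‖z‖ ^ (2 * m.exponent p) : ℝ) : ℂ) * f ((m.chart p).symm z) := by
  rw [m.integral_area_eq_planeArea hf p h0, planeArea,
    integral_withDensity_eq_integral_toReal_smul
      (measurable_norm_rpow _).ennreal_ofReal (ae_of_all _ fun _ => ENNReal.ofReal_lt_top)]
  refine integral_congr_ae (ae_of_all _ fun z => ?_)
  simp only
  rw [ENNReal.toReal_ofReal (by positivity), Complex.real_smul]

theorem lintegral_area [CompactSpace X] {f : X → ENNReal} (hf : AEMeasurable f m.area) (p : X)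
    (h0 : ∀ x ∉ (m.chart p).source, f x = 0) :
    ∫⁻ x, f x ∂m.area = ∫⁻ z in (m.chart p).target,
      ENNReal.ofReal (‖z‖ ^ (2 * m.exponent p)) * f ((m.chart p).symm z) := by
  have hf' : AEMeasurable f (Measure.map (m.chart p).symm (m.planeArea p)) := by
    rw [← localArea_eq_map, ← m.area_restrict_source p]
    exact hf.restrict
  have h1 : ∫⁻ x, f x ∂m.area = ∫⁻ x in (m.chart p).source, f x ∂m.area := by
    rw [← lintegral_indicator (m.chart p).open_source.measurableSet]
    congr 1
    ext x
    by_cases hx : x ∈ (m.chart p).source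
    · rw [Set.indicator_of_mem hx]
    · rw [Set.indicator_of_notMem hx, h0 x hx]
  rw [h1, m.area_restrict_source p, localArea_eq_map,
    lintegral_map' hf' (m.aemeasurable_chart_symm p), planeArea,
    lintegral_withDensity_eq_lintegral_mul₀' (measurable_norm_rpow _).ennreal_ofReal.aemeasurable]
  · rfl
  · exact hf'.comp_aemeasurable (m.aemeasurable_chart_symm p)

end FlatConicalMetric

/-! ### Test functions and Green's identity on the surface -/

namespace FlatConicalMetric

open Filter Topology MeasureTheory

variable {X : Type*} [TopologicalSpace X] [CompactSpace X] [T2Space X] [ChartedSpace ℂ X]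
  [IsManifold 𝓘(ℂ) ω X] (m : FlatConicalMetric X)

omit [CompactSpace X] in
/-- Extension by zero of a smooth function with compact support in a punctured parameter domain. -/
theorem isTest_indicator_chart {p : X} {g : ℂ → ℂ} (hg : ContDiff ℝ ∞ g) (hgs : HasCompactSupport g)
    (ht : tsupport g ⊆ (m.chart p).target \ {0}) :
    m.IsTest ((m.chart p).source.indicator (g ∘ m.chart p)) := by
  set φ := (m.chart p).source.indicator (g ∘ m.chart p) with hφ
  set K := (m.chart p).symm '' tsupport g with hK
  have hKc : IsCompact K :=
    hgs.isCompact.image_of_continuousOn ((m.chart p).continuousOn_symm.mono fun z hz => (ht hz).1)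
  have hs : Function.support φ ⊆ K := by
    intro x hx
    have hxs : x ∈ (m.chart p).source := by
      by_contra h
      exact hx (Set.indicator_of_notMem h _)
    rw [Function.mem_support, hφ, Set.indicator_of_mem hxs] at hx
    exact ⟨m.chart p x, subset_tsupport _ hx, (m.chart p).left_inv hxs⟩
  have hts : tsupport φ ⊆ K := closure_minimal hs hKc.isClosed
  rw [isTest_iff]
  refine ⟨fun x => ?_, fun x hx => ?_⟩
  · by_cases hx : x ∈ (m.chart p).source
    · have : ContMDiffAt 𝓘(ℝ, ℂ) 𝓘(ℝ, ℂ) ∞ (g ∘ m.chart p) x :=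
        (hg.contDiffAt.contMDiffAt).comp x (m.contMDiffAt_chart hx)
      refine this.congr_of_eventuallyEq ?_
      filter_upwards [(m.chart p).open_source.mem_nhds hx] with y hy
      rw [hφ, Set.indicator_of_mem hy]
    · have hxK : x ∉ tsupport φ := fun h => hx (by
        obtain ⟨z, hz, rfl⟩ := hts h
        exact (m.chart p).map_target (ht hz).1)
      exact contMDiffAt_const.congr_of_eventuallyEq (notMem_tsupport_iff_eventuallyEq.1 hxK)
  · obtain ⟨z, hz, rfl⟩ := hts hx
    refine m.exponent_eq_zero ((m.chart p).map_target (ht hz).1) fun h => (ht hz).2 ?_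
    rw [Set.mem_singleton_iff, ← (m.chart p).right_inv (ht hz).1, h, m.chart_self]

/-- A test function is a finite sum of test functions supported in parameter domains. -/
theorem exists_sum_isTest {φ : X → ℂ} (hφ : m.IsTest φ) :
    ∃ (t : Finset X) (φ' : X → X → ℂ), (∀ p, m.IsTest (φ' p)) ∧
      (∀ p ∈ t, tsupport (φ' p) ⊆ (m.chart p).source) ∧ (∀ p, tsupport (φ' p) ⊆ tsupport φ) ∧
      ∑ p ∈ t, φ' p = φ := by
  obtain ⟨t, ht⟩ := isCompact_univ.elim_finite_subcover (fun p : X => (m.chart p).source)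
    (fun p => (m.chart p).open_source) fun p _ => Set.mem_iUnion.2 ⟨p, m.mem_source p⟩
  obtain ⟨χ, hχ⟩ := SmoothPartitionOfUnity.exists_isSubordinate 𝓘(ℝ, ℂ) isClosed_univ
    (fun p : t => (m.chart (p : X)).source) (fun p => (m.chart (p : X)).open_source)
    (by simpa [Set.iUnion_subtype] using ht)
  classical
  rw [isTest_iff] at hφ
  let φ' : X → X → ℂ := fun p x => if h : p ∈ t then ((χ ⟨p, h⟩ x : ℝ) : ℂ) * φ x else 0
  have hφ' : ∀ p (h : p ∈ t), φ' p = fun x => ((χ ⟨p, h⟩ x : ℝ) : ℂ) * φ x := fun p h => by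
    ext x; simp [φ', h]
  have hφ0 : ∀ p (h : p ∉ t), φ' p = fun x => 0 := fun p h => by
    ext x; simp [φ', h]
  have hts : ∀ p, tsupport (φ' p) ⊆ tsupport φ := fun p => by
    by_cases h : p ∈ t
    · rw [hφ' p h]; exact tsupport_mul_subset_right
    · rw [hφ0 p h]; simp [tsupport]
  refine ⟨t, φ', fun p => ?_, fun p hp => ?_, hts, ?_⟩
  · rw [isTest_iff]
    refine ⟨?_, (hts p).trans hφ.2⟩
    by_cases h : p ∈ t
    · rw [hφ' p h]
      simp only [← Complex.real_smul]
      exact (χ ⟨p, h⟩).contMDiff.smul hφ.1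
    · rw [hφ0 p h]; exact contMDiff_const
  · rw [hφ' p hp]
    refine tsupport_mul_subset_left.trans ?_
    refine (closure_mono fun x hx => ?_).trans (hχ ⟨p, hp⟩)
    simpa using hx
  · ext x
    have h1 : ∑ i : t, χ i x = 1 := by
      rw [← finsum_eq_sum_of_fintype]; exact χ.sum_eq_one (Set.mem_univ x)
    have h2 : ∑ p ∈ t, φ' p x = ∑ i : t, ((χ i x : ℝ) : ℂ) * φ x := by
      rw [← Finset.sum_coe_sort]
      exact Finset.sum_congr rfl fun i _ => by rw [hφ' i i.2]
    rw [Finset.sum_apply, h2, ← Finset.sum_mul, ← Complex.ofReal_sum, h1, Complex.ofReal_one,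
      one_mul]

omit [CompactSpace X] [T2Space X] in
theorem continuous_laplacian {φ : X → ℂ} (hφ : m.IsTest φ) : Continuous (m.laplacian φ) := by
  rw [isTest_iff] at hφ
  refine continuous_of_tsupport fun x hx => ?_
  have hx' : x ∈ tsupport φ := by
    refine closure_minimal (fun y hy => ?_) (isClosed_tsupport φ) hx
    by_contra h
    exact hy (m.laplacian_eq_zero_of_notMem_tsupport h)
  exact m.continuousAt_laplacian (hφ.2 hx') ((hφ.1 x).of_le ENat.LEInfty.out)

section

variable {φ ψ : X → ℂ} (hφ : m.IsTest φ)
  (hψ : ∀ x ∈ tsupport φ, ContMDiffAt 𝓘(ℝ, ℂ) 𝓘(ℝ, ℂ) 2 ψ x)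

include hφ hψ

omit [CompactSpace X] [T2Space X] in
theorem continuous_laplacian_mul : Continuous fun x => m.laplacian φ x * ψ x := by
  refine continuous_of_tsupport fun x hx => ?_
  have hx' : x ∈ tsupport φ := by
    refine closure_minimal (fun y hy => ?_) (isClosed_tsupport φ) hx
    by_contra h
    refine hy ?_
    simp only
    rw [m.laplacian_eq_zero_of_notMem_tsupport h, zero_mul]
  exact (m.continuous_laplacian hφ).continuousAt.mul (hψ x hx').continuousAt

omit [CompactSpace X] [T2Space X] in
theorem continuous_mul_laplacian : Continuous fun x => φ x * m.laplacian ψ x := by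
  rw [isTest_iff] at hφ
  refine continuous_of_tsupport fun x hx => ?_
  have hx' : x ∈ tsupport φ := tsupport_mul_subset_left hx
  exact (hφ.1 x).continuousAt.mul (m.continuousAt_laplacian (hφ.2 hx') (hψ x hx'))

variable [MeasurableSpace X] [BorelSpace X]

omit [T2Space X] in
-- The density `|z|^(2b)` of the area cancels the factor `|z|^(-2b)` of the Laplacian, so both
-- integrals become those of Green's identity in the plane.
theorem integral_laplacian_mul_of_tsupport_subset {p : X}
    (hp : tsupport φ ⊆ (m.chart p).source) :
    ∫ x, m.laplacian φ x * ψ x ∂m.area = ∫ x, φ x * m.laplacian ψ x ∂m.area := by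
  have c1 := m.continuous_laplacian_mul hφ hψ
  have c2 := m.continuous_mul_laplacian hφ hψ
  rw [isTest_iff] at hφ
  -- Outside the target the inverse parameter has arbitrary values, so `φ` is cut off there;
  -- compactness of `K` keeps `f` smooth on the whole plane.
  set f : ℂ → ℂ := (m.chart p).target.indicator (φ ∘ (m.chart p).symm) with hf
  set g : ℂ → ℂ := ψ ∘ (m.chart p).symm with hg
  set K := m.chart p '' tsupport φ with hK
  have hKc : IsCompact K := (isClosed_tsupport φ).isCompact.image_of_continuousOn
    ((m.chart p).continuousOn.mono hp)
  have hKt : K ⊆ (m.chart p).target := by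
    rintro _ ⟨x, hx, rfl⟩
    exact (m.chart p).map_source (hp hx)
  have hs : Function.support f ⊆ K := by
    intro z hz
    have hzt : z ∈ (m.chart p).target := by
      by_contra h
      exact hz (Set.indicator_of_notMem h _)
    rw [Function.mem_support, hf, Set.indicator_of_mem hzt] at hz
    exact ⟨(m.chart p).symm z, subset_tsupport _ hz, (m.chart p).right_inv hzt⟩
  have hts : tsupport f ⊆ K := closure_minimal hs hKc.isClosed
  have hfe : ∀ z ∈ (m.chart p).target, f =ᶠ[𝓝 z] φ ∘ (m.chart p).symm := fun z hz => by
    filter_upwards [(m.chart p).open_target.mem_nhds hz] with w hw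
    rw [hf, Set.indicator_of_mem hw]
  have hf0 : ∀ z, z ∉ K → Laplacian.laplacian f z = 0 := by
    intro z hz
    rw [(InnerProductSpace.laplacian_congr_nhds
      (notMem_tsupport_iff_eventuallyEq.1 fun h => hz (hts h))).eq_of_nhds]
    exact congrFun (InnerProductSpace.laplacian_const (c := (0 : ℂ))) z
  have hmemK : ∀ z ∈ (m.chart p).target, z ∈ K → (m.chart p).symm z ∈ tsupport φ := by
    rintro z hz ⟨x, hx, rfl⟩
    rwa [(m.chart p).left_inv (hp hx)]
  have hfC : ContDiff ℝ 2 f := by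
    rw [contDiff_iff_contDiffAt]
    intro z
    by_cases hz : z ∈ (m.chart p).target
    · refine ContDiffAt.congr_of_eventuallyEq ?_ (hfe z hz)
      have := m.contDiffAt_comp_chart_symm (n := 2) ((m.chart p).map_target hz)
        ((hφ.1 ((m.chart p).symm z)).of_le ENat.LEInfty.out)
      rwa [(m.chart p).right_inv hz] at this
    · exact contDiffAt_const.congr_of_eventuallyEq
        (notMem_tsupport_iff_eventuallyEq.1 fun h => hz (hKt (hts h)))
  have hgC : ∀ z ∈ tsupport f, ContDiffAt ℝ 2 g z := by
    intro z hz
    obtain ⟨x, hx, rfl⟩ := hts hz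
    exact m.contDiffAt_comp_chart_symm (hp hx) (hψ x hx)
  have green := integral_mul_laplacian hfC (hKc.of_isClosed_subset (isClosed_tsupport f) hts) hgC
  have e1 : ∫ x, m.laplacian φ x * ψ x ∂m.area = -∫ z, Laplacian.laplacian f z * g z := by
    rw [m.integral_area c1.aestronglyMeasurable p, ← integral_neg,
      ← setIntegral_eq_integral_of_forall_compl_eq_zero (s := (m.chart p).target)
        (f := fun z => -(Laplacian.laplacian f z * g z))]
    · refine setIntegral_congr_fun (m.chart p).open_target.measurableSet fun z hz => ?_
      by_cases hzK : z ∈ K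
      · have hx := hmemK z hz hzK
        have h1 := m.laplacian_chart (φ := φ) (hp hx) (hφ.2 hx) ((hφ.1 _).of_le ENat.LEInfty.out)
        rw [(m.chart p).right_inv hz] at h1
        rw [← mul_assoc, h1, (InnerProductSpace.laplacian_congr_nhds (hfe z hz)).eq_of_nhds,
          neg_mul]
        rfl
      · have hx : (m.chart p).symm z ∉ tsupport φ := fun h =>
          hzK ⟨_, h, (m.chart p).right_inv hz⟩
        rw [hf0 z hzK, m.laplacian_eq_zero_of_notMem_tsupport hx]
        simp
    · intro z hz
      rw [hf0 z fun h => hz (hKt h)]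
      simp
    · intro x hx
      rw [m.laplacian_eq_zero_of_notMem_tsupport fun h => hx (hp h), zero_mul]
  have e2 : ∫ x, φ x * m.laplacian ψ x ∂m.area = -∫ z, f z * Laplacian.laplacian g z := by
    rw [m.integral_area c2.aestronglyMeasurable p, ← integral_neg,
      ← setIntegral_eq_integral_of_forall_compl_eq_zero (s := (m.chart p).target)
        (f := fun z => -(f z * Laplacian.laplacian g z))]
    · refine setIntegral_congr_fun (m.chart p).open_target.measurableSet fun z hz => ?_
      rw [hf, Set.indicator_of_mem hz]
      by_cases hx : (m.chart p).symm z ∈ tsupport φ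
      · have h1 := m.laplacian_chart (φ := ψ) (hp hx) (hφ.2 hx) (hψ _ hx)
        rw [(m.chart p).right_inv hz] at h1
        rw [mul_left_comm, h1, mul_neg]
        rfl
      · simp [image_eq_zero_of_notMem_tsupport hx]
    · intro z hz
      rw [hf, Set.indicator_of_notMem hz]
      simp
    · intro x hx
      rw [image_eq_zero_of_notMem_tsupport fun h => hx (hp h), zero_mul]
  rw [e1, e2, green]

omit [T2Space X] hφ hψ in
theorem integrable_of_continuous {f : X → ℂ} (hf : Continuous f) : Integrable f m.area :=
  hf.integrable_of_hasCompactSupport (HasCompactSupport.of_compactSpace f)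

/-- Green's identity. -/
theorem integral_laplacian_mul :
    ∫ x, m.laplacian φ x * ψ x ∂m.area = ∫ x, φ x * m.laplacian ψ x ∂m.area := by
  obtain ⟨t, φ', h1, h2, h3, h4⟩ := m.exists_sum_isTest hφ
  have hψ' : ∀ p, ∀ x ∈ tsupport (φ' p), ContMDiffAt 𝓘(ℝ, ℂ) 𝓘(ℝ, ℂ) 2 ψ x :=
    fun p x hx => hψ x (h3 p hx)
  have e1 : ∀ x, m.laplacian φ x * ψ x = ∑ p ∈ t, m.laplacian (φ' p) x * ψ x := by
    intro x
    rw [← Finset.sum_mul, ← m.laplacian_sum t, h4]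
    exact fun p _ => ((m.isTest_iff.1 (h1 p)).1 x).of_le ENat.LEInfty.out
  have e2 : ∀ x, φ x * m.laplacian ψ x = ∑ p ∈ t, φ' p x * m.laplacian ψ x := by
    intro x
    rw [← Finset.sum_mul, ← Finset.sum_apply, h4]
  simp only [e1, e2]
  rw [integral_finsetSum _ fun p _ => m.integrable_of_continuous
      (m.continuous_laplacian_mul (h1 p) (hψ' p)),
    integral_finsetSum _ fun p _ => m.integrable_of_continuous
      (m.continuous_mul_laplacian (h1 p) (hψ' p))]
  exact Finset.sum_congr rfl fun p hp =>
    m.integral_laplacian_mul_of_tsupport_subset (h1 p) (hψ' p) (h2 p hp)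

end

end FlatConicalMetric

/-! ### The minimal Laplacian: density, symmetry, nonnegativity -/

/-- A densely defined nonnegative symmetric linear relation is the graph of an operator, whose
closure has the same properties. -/
theorem Submodule.toLinearPMap_closure_of_symmetric {H : Type*} [NormedAddCommGroup H]
    [InnerProductSpace ℂ H] [CompleteSpace H] {g : Submodule ℂ (H × H)}
    (hd : Dense (g.map (LinearMap.fst ℂ H H) : Set H))
    (hs : ∀ a ∈ g, ∀ b ∈ g, inner ℂ a.2 b.1 = inner ℂ a.1 b.2)
    (hp : ∀ a ∈ g, 0 ≤ (inner ℂ a.1 a.2).re) :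
    Dense (g.toLinearPMap.closure.domain : Set H) ∧
    g.toLinearPMap.closure.IsFormalAdjoint g.toLinearPMap.closure ∧
    (∀ u : g.toLinearPMap.closure.domain,
      0 ≤ (inner ℂ (u : H) (g.toLinearPMap.closure u)).re) ∧
    ∀ w w' : H, (∀ a ∈ g, inner ℂ w' a.1 = inner ℂ w a.2) →
      w ∈ g.toLinearPMap.closure.adjoint.domain := by
  -- The relation is single valued: if `(0, y)` belongs to it, symmetry makes `y` orthogonal to the
  -- dense domain.
  have hg : g.toLinearPMap.graph = g := by
    refine g.toLinearPMap_graph_eq fun a ha h0 => ?_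
    refine hd.eq_zero_of_inner_left ℂ fun b hb => ?_
    obtain ⟨b, hb, rfl⟩ := hb
    have := hs a ha b hb
    rwa [h0, inner_zero_left] at this
  have hmem : ∀ u : g.toLinearPMap.domain, ((u : H), g.toLinearPMap u) ∈ g := fun u => by
    have := g.toLinearPMap.mem_graph u
    rwa [hg] at this
  have hd0 : Dense (g.toLinearPMap.domain : Set H) := hd
  have hfa : g.toLinearPMap.IsFormalAdjoint g.toLinearPMap := fun u v => hs _ (hmem u) _ (hmem v)
  -- By symmetry the operator is contained in its adjoint, which is closed.
  have hcl : g.toLinearPMap.IsClosable :=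
    (LinearPMap.adjoint_isClosed hd0).isClosable.leIsClosable (hfa.le_adjoint hd0)
  have hgc := hcl.graph_closure_eq_closure_graph
  rw [hg] at hgc
  have hmemc : ∀ u : g.toLinearPMap.closure.domain,
      ((u : H), g.toLinearPMap.closure u) ∈ closure (g : Set (H × H)) := fun u => by
    have := g.toLinearPMap.closure.mem_graph u
    rw [← hgc] at this
    exact this
  refine ⟨hd0.mono g.toLinearPMap.le_closure.1, fun u v => ?_, fun u => ?_, fun w w' hw => ?_⟩
  · have key : ∀ a ∈ closure (g : Set (H × H)), ∀ b ∈ closure (g : Set (H × H)),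
        inner ℂ a.2 b.1 = inner ℂ a.1 b.2 := by
      intro a ha b hb
      refine closure_minimal (t := {a : H × H | inner ℂ a.2 b.1 = inner ℂ a.1 b.2}) (fun a ha => ?_)
        (isClosed_eq (by fun_prop) (by fun_prop)) ha
      exact closure_minimal (t := {b : H × H | inner ℂ a.2 b.1 = inner ℂ a.1 b.2}) (fun b hb => hs a ha b hb)
        (isClosed_eq (by fun_prop) (by fun_prop)) hb
    exact key _ (hmemc u) _ (hmemc v)
  · exact closure_minimal (t := {a : H × H | 0 ≤ (inner ℂ a.1 a.2).re}) (fun a ha => hp a ha)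
      (isClosed_le continuous_const (by fun_prop)) (hmemc u)
  · refine LinearPMap.mem_adjoint_domain_of_exists w ⟨w', fun u => ?_⟩
    exact closure_minimal (t := {a : H × H | inner ℂ w' a.1 = inner ℂ w a.2})
      (fun a ha => hw a ha) (isClosed_eq (by fun_prop) (by fun_prop)) (hmemc u)

namespace FlatConicalMetric

open Filter Topology MeasureTheory

variable {X : Type*} [TopologicalSpace X] [CompactSpace X] [T2Space X] [ChartedSpace ℂ X]
  [IsManifold 𝓘(ℂ) ω X] (m : FlatConicalMetric X)

section

omit [CompactSpace X] [T2Space X]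

theorem isTest_add {φ ψ : X → ℂ} (hφ : m.IsTest φ) (hψ : m.IsTest ψ) : m.IsTest (φ + ψ) := by
  rw [isTest_iff] at hφ hψ ⊢
  exact ⟨hφ.1.add hψ.1, (tsupport_add φ ψ).trans (Set.union_subset hφ.2 hψ.2)⟩

theorem isTest_smul (c : ℂ) {φ : X → ℂ} (hφ : m.IsTest φ) : m.IsTest (c • φ) := by
  rw [isTest_iff] at hφ ⊢
  refine ⟨?_, (closure_mono (Function.support_const_smul_subset c φ)).trans hφ.2⟩
  exact (ContinuousLinearMap.mul ℝ ℂ c).contDiff.contMDiff.comp hφ.1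

theorem isTest_conj {φ : X → ℂ} (hφ : m.IsTest φ) : m.IsTest fun x => starRingEnd ℂ (φ x) := by
  rw [isTest_iff] at hφ ⊢
  refine ⟨Complex.conjCLE.contDiff.contMDiff.comp hφ.1, (closure_mono fun x hx => ?_).trans hφ.2⟩
  simpa using hx

theorem isTest_mul_conj {φ : X → ℂ} (hφ : m.IsTest φ) :
    m.IsTest fun x => φ x * starRingEnd ℂ (φ x) := by
  have h := m.isTest_conj hφ
  have h' := m.isTest_iff.1 hφ
  refine ⟨fun p => (hφ.1 p).mul (h.1 p), tsupport_mul_subset_left.trans h'.2⟩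

theorem isTest_zero : m.IsTest 0 :=
  ⟨fun _ => contDiffOn_const, by simp [tsupport]⟩

end

variable [MeasurableSpace X] [BorelSpace X]

omit [T2Space X] in
theorem memLp_of_continuous {f : X → ℂ} (hf : Continuous f) : MemLp f 2 m.area :=
  hf.memLp_of_hasCompactSupport (HasCompactSupport.of_compactSpace f)

/-- Pairs `(φ, Δφ)` of a test function and its Laplacian, as elements of `L² × L²`. -/
noncomputable def testGraph : Submodule ℂ (m.L2 × m.L2) :=
  Submodule.span ℂ {uf : m.L2 × m.L2 | ∃ φ : X → ℂ, m.IsTest φ ∧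
    uf.1 =ᵐ[m.area] φ ∧ uf.2 =ᵐ[m.area] m.laplacian φ}

omit [CompactSpace X] [T2Space X] [BorelSpace X] in
-- Test functions form a vector space on which the Laplacian is linear, so the span adds no new
-- pairs.
theorem mem_testGraph {a : m.L2 × m.L2} (ha : a ∈ m.testGraph) :
    ∃ φ : X → ℂ, m.IsTest φ ∧ a.1 =ᵐ[m.area] φ ∧ a.2 =ᵐ[m.area] m.laplacian φ := by
  have hC : ∀ φ, m.IsTest φ → ∀ x, ContMDiffAt 𝓘(ℝ, ℂ) 𝓘(ℝ, ℂ) 2 φ x := fun φ h x =>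
    ((m.isTest_iff.1 h).1 x).of_le ENat.LEInfty.out
  induction ha using Submodule.span_induction with
  | mem a ha => exact ha
  | zero =>
    refine ⟨0, m.isTest_zero, Lp.coeFn_zero _ _ _, ?_⟩
    have : m.laplacian 0 = 0 := funext fun x =>
      m.laplacian_eq_zero_of_notMem_tsupport (by simp [tsupport])
    rw [this]
    exact Lp.coeFn_zero _ _ _
  | add a b _ _ iha ihb =>
    obtain ⟨φ, h1, h2, h3⟩ := iha
    obtain ⟨ψ, k1, k2, k3⟩ := ihb
    refine ⟨φ + ψ, m.isTest_add h1 k1, (Lp.coeFn_add _ _).trans (h2.add k2), ?_⟩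
    rw [show m.laplacian (φ + ψ) = m.laplacian φ + m.laplacian ψ from
      funext fun x => m.laplacian_add (hC _ h1 x) (hC _ k1 x)]
    exact (Lp.coeFn_add _ _).trans (h3.add k3)
  | smul c a _ iha =>
    obtain ⟨φ, h1, h2, h3⟩ := iha
    refine ⟨c • φ, m.isTest_smul c h1, (Lp.coeFn_smul _ _).trans (h2.const_smul c), ?_⟩
    rw [show m.laplacian (c • φ) = c • m.laplacian φ from
      funext fun x => m.laplacian_smul c (hC _ h1 x)]
    exact (Lp.coeFn_smul _ _).trans (h3.const_smul c)

omit [T2Space X] in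
theorem exists_mem_testGraph {φ : X → ℂ} (hφ : m.IsTest φ) :
    ∃ a ∈ m.testGraph, a.1 =ᵐ[m.area] φ := by
  have h1 := m.memLp_of_continuous (m.isTest_iff.1 hφ).1.continuous
  have h2 := m.memLp_of_continuous (m.continuous_laplacian hφ)
  exact ⟨(h1.toLp, h2.toLp), Submodule.subset_span ⟨φ, hφ, h1.coeFn_toLp, h2.coeFn_toLp⟩,
    h1.coeFn_toLp⟩

omit [CompactSpace X] [T2Space X] [BorelSpace X] in
theorem inner_eq_integral {u v : m.L2} {φ ψ : X → ℂ} (hu : u =ᵐ[m.area] φ) (hv : v =ᵐ[m.area] ψ) :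
    inner ℂ u v = ∫ x, ψ x * starRingEnd ℂ (φ x) ∂m.area := by
  rw [MeasureTheory.L2.inner_def]
  refine integral_congr_ae ?_
  filter_upwards [hu, hv] with x h1 h2
  rw [h1, h2, RCLike.inner_apply]

/-- Green's identity for a function that is smooth away from the conical points. -/
theorem inner_testGraph_right {a : m.L2 × m.L2} (ha : a ∈ m.testGraph) {w w' : m.L2} {ψ : X → ℂ}
    (hψ : ∀ x, m.exponent x = 0 → ContMDiffAt 𝓘(ℝ, ℂ) 𝓘(ℝ, ℂ) 2 ψ x)
    (hw : w =ᵐ[m.area] ψ) (hw' : w' =ᵐ[m.area] m.laplacian ψ) :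
    inner ℂ w' a.1 = inner ℂ w a.2 := by
  obtain ⟨φ, h1, h2, h3⟩ := m.mem_testGraph ha
  have h0 := (m.isTest_iff.1 h1).2
  rw [m.inner_eq_integral hw' h2, m.inner_eq_integral hw h3,
    m.integral_laplacian_mul (ψ := fun x => starRingEnd ℂ (ψ x)) h1 fun x hx =>
      Complex.conjCLE.contDiff.contDiffAt.contMDiffAt.comp x (hψ x (h0 hx))]
  refine integral_congr_ae (ae_of_all _ fun x => ?_)
  simp only
  by_cases hx : x ∈ tsupport φ
  · rw [m.laplacian_conj (hψ x (h0 hx))]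
  · rw [image_eq_zero_of_notMem_tsupport hx, zero_mul, zero_mul]

theorem testGraph_symmetric : ∀ a ∈ m.testGraph, ∀ b ∈ m.testGraph,
    inner ℂ a.2 b.1 = inner ℂ a.1 b.2 := by
  intro a ha b hb
  obtain ⟨φ, h1, h2, h3⟩ := m.mem_testGraph ha
  exact m.inner_testGraph_right hb
    (fun x _ => ((m.isTest_iff.1 h1).1 x).of_le ENat.LEInfty.out) h2 h3

/-- For the nonnegative Laplacian, `Δ|φ|² ≤ 2 Re(φ̄ Δφ)` pointwise, and `Δ|φ|²` has integral zero by
Green's identity against the constant `1`. No integral of a gradient is needed. -/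
theorem testGraph_nonneg : ∀ a ∈ m.testGraph, 0 ≤ (inner ℂ a.1 a.2).re := by
  intro a ha
  obtain ⟨φ, h1, h2, h3⟩ := m.mem_testGraph ha
  have hC : ∀ x, ContMDiffAt 𝓘(ℝ, ℂ) 𝓘(ℝ, ℂ) 2 φ x := fun x =>
    ((m.isTest_iff.1 h1).1 x).of_le ENat.LEInfty.out
  rw [m.inner_eq_integral h2 h3]
  have hsq := m.isTest_mul_conj h1
  have hzero : ∫ x, m.laplacian (fun x => φ x * starRingEnd ℂ (φ x)) x ∂m.area = 0 := by
    have h := m.integral_laplacian_mul (ψ := fun _ => 1) hsq fun x _ => contMDiffAt_const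
    have h4 : ∀ x, m.laplacian (fun _ => 1) x = 0 := fun x => by
      rw [laplacian]
      erw [InnerProductSpace.laplacian_const]
      simp
    simpa [h4] using h
  have i1 : Integrable (fun x => m.laplacian φ x * starRingEnd ℂ (φ x)) m.area :=
    m.integrable_of_continuous ((m.continuous_laplacian h1).mul
      (m.isTest_iff.1 (m.isTest_conj h1)).1.continuous)
  have i2 := m.integrable_of_continuous (m.continuous_laplacian hsq)
  have e1 : (∫ x, m.laplacian φ x * starRingEnd ℂ (φ x) ∂m.area).re
      = ∫ x, (m.laplacian φ x * starRingEnd ℂ (φ x)).re ∂m.area := (integral_re i1).symm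
  have e2 : (∫ x, m.laplacian (fun x => φ x * starRingEnd ℂ (φ x)) x ∂m.area).re
      = ∫ x, (m.laplacian (fun x => φ x * starRingEnd ℂ (φ x)) x).re ∂m.area :=
    (integral_re i2).symm
  rw [hzero, Complex.zero_re] at e2
  have hle : ∫ x, (m.laplacian (fun x => φ x * starRingEnd ℂ (φ x)) x).re ∂m.area
      ≤ ∫ x, 2 * (m.laplacian φ x * starRingEnd ℂ (φ x)).re ∂m.area := by
    refine integral_mono i2.re (i1.re.const_mul 2) fun x => ?_
    have h := two_mul_re_laplacian_mul_conj_le (m.contDiffAt_two_at_zero (hC x))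
    have hx : (φ ∘ (m.chart x).symm) 0 = φ x := by
      rw [← m.chart_self x, Function.comp_apply, (m.chart x).left_inv (m.mem_source x)]
    rw [hx] at h
    simp only [laplacian, Complex.neg_re, neg_mul]
    change -_ ≤ 2 * -_
    have e : (fun w => (φ ∘ (m.chart x).symm) w * starRingEnd ℂ ((φ ∘ (m.chart x).symm) w))
      = (fun x => φ x * starRingEnd ℂ (φ x)) ∘ (m.chart x).symm := rfl
    rw [e] at h
    linarith
  rw [← e2, integral_const_mul, ← e1] at hle
  linarith

omit [T2Space X] in
theorem ae_of_forall_localArea {P : X → Prop} (hP : ∀ p, ∀ᵐ x ∂m.localArea p, P x) :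
    ∀ᵐ x ∂m.area, P x := by
  by_cases hne : Nonempty X
  · obtain ⟨e, he⟩ := m.exists_countable_cover
    rw [← Measure.restrict_univ (μ := m.area), ← he, ae_restrict_iUnion_iff]
    intro n
    rw [m.area_restrict_source]
    exact hP _
  · exact ae_of_all _ fun x => (hne ⟨x⟩).elim

/-- Let `v` be orthogonal to all test functions. In each parameter domain it integrates to zero
against every bump function supported off the origin, hence vanishes almost everywhere there. -/
theorem dense_testGraph : Dense (m.testGraph.map (LinearMap.fst ℂ m.L2 m.L2) : Set m.L2) := by
  rw [Submodule.dense_iff_topologicalClosure_eq_top, Submodule.topologicalClosure_eq_top_iff,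
    Submodule.eq_bot_iff]
  intro v hv
  rw [Submodule.mem_orthogonal] at hv
  rw [Lp.eq_zero_iff_ae_eq_zero]
  have hvi : Integrable v m.area := (Lp.memLp v).integrable (by norm_num)
  refine m.ae_of_forall_localArea fun p => ?_
  have hms : MeasurableSet {x | v x = (0 : X → ℂ) x} :=
    measurableSet_eq_fun (Lp.stronglyMeasurable v).measurable measurable_const
  rw [localArea_eq_map, ae_map_iff (m.aemeasurable_chart_symm p) hms]
  have hvp : Integrable (v ∘ (m.chart p).symm) (m.planeArea p) := by
    have h1 : Integrable v (m.localArea p) := by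
      rw [← m.area_restrict_source p]
      exact hvi.restrict
    exact h1.comp_aemeasurable (m.aemeasurable_chart_symm p)
  -- Only the centre of a parameter domain can be conical. It is removed for every `p`, which is
  -- harmless because a point is a null set.
  have hU : IsOpen ((m.chart p).target \ {0}) :=
    (m.chart p).open_target.sdiff isClosed_singleton
  have hz : ∀ᵐ z ∂m.planeArea p, z ≠ 0 := by
    refine withDensity_absolutelyContinuous _ _ (ae_restrict_of_ae ?_)
    exact compl_mem_ae_iff.2 (measure_singleton _)
  have key := hU.ae_eq_zero_of_integral_contDiff_smul_eq_zero (μ := m.planeArea p)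
    (hvp.locallyIntegrable.locallyIntegrableOn _) fun g hg hgs hgt => by
      have ht : tsupport (fun z => (g z : ℂ)) ⊆ tsupport g :=
        closure_mono fun z hz => by simpa using hz
      have hφ := m.isTest_indicator_chart (p := p) (g := fun z => (g z : ℂ))
        (Complex.ofRealCLM.contDiff.comp hg)
        (hgs.of_isClosed_subset (isClosed_tsupport _) ht) (ht.trans hgt)
      obtain ⟨a, ha, hae⟩ := m.exists_mem_testGraph hφ
      have h0 := hv a.1 ⟨a, ha, rfl⟩
      have hmeas : AEStronglyMeasurable (fun x => v x * starRingEnd ℂ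
          ((m.chart p).source.indicator ((fun z => (g z : ℂ)) ∘ m.chart p) x)) m.area :=
        (Lp.aestronglyMeasurable v).mul
          (m.isTest_iff.1 (m.isTest_conj hφ)).1.continuous.aestronglyMeasurable
      rw [m.inner_eq_integral hae (EventuallyEq.refl _ v), m.integral_area_eq_planeArea hmeas p
        fun x hx => by rw [Set.indicator_of_notMem hx, map_zero, mul_zero]] at h0
      rw [← h0]
      refine integral_congr_ae ?_
      filter_upwards [m.ae_mem_target p] with z hz
      rw [Set.indicator_of_mem ((m.chart p).map_target hz)]
      simp only [Function.comp_apply, (m.chart p).right_inv hz, Complex.conj_ofReal,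
        Complex.real_smul, mul_comm]
  filter_upwards [key, hz, m.ae_mem_target p] with z h1 h2 h3
  exact h1 ⟨h3, h2⟩

/-- The first three clauses are all that the resolvent argument takes from the geometry; the fourth
says that a square integrable weak Laplacian suffices for membership in `dom Δ*`. -/
theorem laplaceMin_properties :
    Dense (m.laplaceMin.domain : Set m.L2) ∧ m.laplaceMin.IsFormalAdjoint m.laplaceMin ∧
    (∀ u : m.laplaceMin.domain, 0 ≤ (inner ℂ (u : m.L2) (m.laplaceMin u)).re) ∧
    ∀ w w' : m.L2, (∀ a ∈ m.testGraph, inner ℂ w' a.1 = inner ℂ w a.2) →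
      w ∈ m.laplaceMax.domain :=
  Submodule.toLinearPMap_closure_of_symmetric m.dense_testGraph m.testGraph_symmetric
    m.testGraph_nonneg

/-- A square integrable function which is smooth away from the conical points and has a square
integrable Laplacian belongs to the domain of the maximal extension. -/
theorem exists_mem_laplaceMax {ψ : X → ℂ}
    (hψ : ∀ x, m.exponent x = 0 → ContMDiffAt 𝓘(ℝ, ℂ) 𝓘(ℝ, ℂ) 2 ψ x)
    (h1 : MemLp ψ 2 m.area) (h2 : MemLp (m.laplacian ψ) 2 m.area) :
    ∃ u : m.laplaceMax.domain, (u : m.L2) =ᵐ[m.area] ψ :=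
  ⟨⟨h1.toLp, m.laplaceMin_properties.2.2.2 _ h2.toLp fun _ ha =>
    m.inner_testGraph_right ha hψ h1.coeFn_toLp h2.coeFn_toLp⟩, h1.coeFn_toLp⟩

end FlatConicalMetric

/-! ### The singular functions in the distinguished parameter -/

open InnerProductSpace in
theorem harmonicAt_ofReal_log_norm {z : ℂ} (hz : z ≠ 0) :
    HarmonicAt (fun w : ℂ => ((Real.log ‖w‖ : ℝ) : ℂ)) z :=
  (analyticAt_id.harmonicAt_log_norm hz).comp_CLM Complex.ofRealCLM

open InnerProductSpace in
/-- In polar coordinates, `r^(-|k|) exp(ikθ)` is harmonic. -/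
theorem harmonicAt_norm_rpow_mul_zpow (k : ℤ) {z : ℂ} (hz : z ≠ 0) :
    HarmonicAt (fun w : ℂ => ((‖w‖ ^ (-|(k : ℝ)|) : ℝ) : ℂ) * (w / (‖w‖ : ℂ)) ^ k) z := by
  have han : ∀ j : ℤ, AnalyticAt ℂ (fun w : ℂ => w ^ j) z := fun j => analyticAt_id.zpow hz
  have hne : ∀ᶠ w in nhds z, w ≠ 0 := isOpen_ne.mem_nhds hz
  rcases le_or_gt 0 k with hk | hk
  -- For `k ≥ 0` the function is the complex conjugate of `w ^ (-k)`.
  · refine (harmonicAt_congr_nhds ?_).2 (han (-k)).harmonicAt_conj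
    filter_upwards [hne] with w hw
    have hw' : (‖w‖ : ℂ) ≠ 0 := by simpa using hw
    have hc : (starRingEnd ℂ) w ≠ 0 := by simpa using hw
    have e : (‖w‖ : ℂ) * ‖w‖ = w * starRingEnd ℂ w := by
      rw [Complex.mul_conj, Complex.normSq_eq_norm_sq]; push_cast; ring
    rw [abs_of_nonneg (by exact_mod_cast hk), Real.rpow_neg (norm_nonneg _), Real.rpow_intCast,
      div_zpow]
    change _ = starRingEnd ℂ (w ^ (-k))
    rw [map_zpow₀, zpow_neg]
    push_cast
    rw [← mul_div_assoc, inv_mul_eq_div, div_div, ← mul_zpow, e, mul_zpow, div_mul_eq_div_div,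
      div_self (zpow_ne_zero _ hw), one_div]
  -- For `k < 0` it is `w ^ k` itself.
  · refine (harmonicAt_congr_nhds ?_).2 (han k).harmonicAt
    filter_upwards [hne] with w hw
    have hw' : (‖w‖ : ℂ) ≠ 0 := by simpa using hw
    rw [abs_of_neg (by exact_mod_cast hk), neg_neg, Real.rpow_intCast, div_zpow]
    push_cast
    rw [mul_div_cancel₀ _ (zpow_ne_zero _ hw')]

namespace FlatConicalMetric

open Filter Topology MeasureTheory

variable {X : Type*} [TopologicalSpace X] [ChartedSpace ℂ X]
  [IsManifold 𝓘(ℂ) ω X] (m : FlatConicalMetric X)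

section

variable {m} (C : ℝ) (ρ : ℝ → ℝ) (ν : m.Index)

/-- The singular function of an index, as a function of the distinguished parameter. -/
noncomputable def singularChart (z : ℂ) : ℂ :=
  if ν.k = 0 then ((C * Real.log (m.radius ν.point z) * ρ (m.radius ν.point z) : ℝ) : ℂ)
  else ((C * m.radius ν.point z ^ (-|ν.value|) * ρ (m.radius ν.point z) : ℝ) : ℂ)
    * (z / (‖z‖ : ℂ)) ^ ν.k

theorem singularFun_eq_indicator : m.singularFun C ρ ν
    = (m.chart ν.point).source.indicator (singularChart C ρ ν ∘ m.chart ν.point) := by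
  ext x
  by_cases hx : x ∈ (m.chart ν.point).source
  · rw [Set.indicator_of_mem hx, singularFun, if_pos hx]; rfl
  · rw [Set.indicator_of_notMem hx, singularFun, if_neg hx]

variable (m) in
theorem exponent_add_one_pos (p : X) : 0 < m.exponent p + 1 := by linarith [m.exponent_gt p]

variable (m) in
theorem radius_pos (p : X) {z : ℂ} (hz : z ≠ 0) : 0 < m.radius p z :=
  div_pos (Real.rpow_pos_of_pos (norm_pos_iff.2 hz) _) (m.exponent_add_one_pos p)

variable (m) in
theorem radius_zero (p : X) : m.radius p 0 = 0 := by
  rw [radius, norm_zero, Real.zero_rpow (m.exponent_add_one_pos p).ne', zero_div]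

variable (m) in
theorem continuous_radius (p : X) : Continuous (m.radius p) :=
  (continuous_norm.rpow_const fun _ => Or.inr (m.exponent_add_one_pos p).le).div_const _

variable (m) in
theorem contDiffAt_radius (p : X) {z : ℂ} (hz : z ≠ 0) : ContDiffAt ℝ ∞ (m.radius p) z :=
  ((contDiffAt_norm ℝ hz).rpow_const_of_ne (norm_ne_zero_iff.2 hz)).div_const _

variable (m) in
theorem radius_rpow (p : X) (z : ℂ) (s : ℝ) : m.radius p z ^ s
    = ‖z‖ ^ ((m.exponent p + 1) * s) * ((m.exponent p + 1) ^ s)⁻¹ := by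
  rw [radius, Real.div_rpow (by positivity) (m.exponent_add_one_pos p).le,
    ← Real.rpow_mul (norm_nonneg _), div_eq_mul_inv]

variable (m) in
theorem isCompact_radius_le (p : X) {δ : ℝ} : IsCompact {z | m.radius p z ≤ δ} := by
  have hβ := m.exponent_add_one_pos p
  refine Metric.isCompact_of_isClosed_isBounded (isClosed_le (m.continuous_radius p)
    continuous_const) ((Metric.isBounded_closedBall (x := (0 : ℂ))
      (r := (δ * (m.exponent p + 1)) ^ (m.exponent p + 1)⁻¹)).subset fun z hz => ?_)
  have h1 : ‖z‖ ^ (m.exponent p + 1) ≤ δ * (m.exponent p + 1) := (div_le_iff₀ hβ).1 hz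
  have h2 := Real.rpow_le_rpow (by positivity) h1 (inv_nonneg.2 hβ.le)
  rw [← Real.rpow_mul (norm_nonneg _), mul_inv_cancel₀ hβ.ne', Real.rpow_one] at h2
  simpa using h2

theorem abs_value : |ν.value| = |(ν.k : ℝ)| / (m.exponent ν.point + 1) := by
  rw [Index.value, abs_div, abs_of_pos (m.exponent_add_one_pos ν.point)]

theorem abs_value_lt_one : |ν.value| < 1 := by
  rw [abs_value, div_lt_one (m.exponent_add_one_pos ν.point)]
  exact ν.k_lt

variable {C ρ ν}

theorem contDiffAt_singularChart (hρ : ContDiff ℝ ∞ ρ) {z : ℂ} (hz : z ≠ 0) :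
    ContDiffAt ℝ ∞ (singularChart C ρ ν) z := by
  have hr := m.contDiffAt_radius ν.point hz
  have hr0 := (m.radius_pos ν.point hz).ne'
  have hρr : ContDiffAt ℝ ∞ (fun z => ρ (m.radius ν.point z)) z := hρ.contDiffAt.comp z hr
  have hof : ∀ {u : ℂ → ℝ}, ContDiffAt ℝ ∞ u z → ContDiffAt ℝ ∞ (fun z => ((u z : ℝ) : ℂ)) z :=
    fun hu => Complex.ofRealCLM.contDiff.contDiffAt.comp z hu
  by_cases hk : ν.k = 0
  · have : singularChart C ρ ν = fun z =>
        ((C * Real.log (m.radius ν.point z) * ρ (m.radius ν.point z) : ℝ) : ℂ) :=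
      funext fun z => if_pos hk
    rw [this]
    exact hof ((contDiffAt_const.mul (hr.log hr0)).mul hρr)
  · have : singularChart C ρ ν = fun z =>
        ((C * m.radius ν.point z ^ (-|ν.value|) * ρ (m.radius ν.point z) : ℝ) : ℂ)
          * (z / (‖z‖ : ℂ)) ^ ν.k := funext fun z => if_neg hk
    rw [this]
    refine (hof ((contDiffAt_const.mul (hr.rpow_const_of_ne hr0)).mul hρr)).mul ?_
    have hn : ((‖z‖ : ℝ) : ℂ) ≠ 0 := by simpa using hz
    have h1 : ContDiffAt ℝ ∞ (fun z : ℂ => z / (‖z‖ : ℂ)) z :=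
      by
      have h3 : ContDiffAt ℝ ∞ (fun w : ℂ => ‖w‖⁻¹ • w) z :=
        ((contDiffAt_norm ℝ hz).inv (norm_ne_zero_iff.2 hz)).smul contDiffAt_id
      refine h3.congr_of_eventuallyEq (Filter.Eventually.of_forall fun w => ?_)
      simp only [Complex.real_smul, Complex.ofReal_inv, div_eq_inv_mul]
    have h2 : AnalyticAt ℂ (fun w : ℂ => w ^ ν.k) (z / (‖z‖ : ℂ)) :=
      analyticAt_id.zpow (div_ne_zero hz hn)
    exact (h2.contDiffAt.restrict_scalars ℝ).comp z h1

open InnerProductSpace in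
-- Since `r = |z|^(b+1)/(b+1)`, `ln r` is affine in `ln |z|` and `r^(-|ν|)` is a constant multiple
-- of `|z|^(-|k|)`. Where the cut-off is `1`, only these model functions remain.
theorem eventually_harmonicAt_singularChart (hρ : ∀ᶠ t in 𝓝 0, ρ t = 1) :
    ∀ᶠ z in 𝓝 (0 : ℂ), z ≠ 0 → HarmonicAt (singularChart C ρ ν) z := by
  have h0 : Tendsto (m.radius ν.point) (𝓝 0) (𝓝 0) := by
    have := (m.continuous_radius ν.point).tendsto 0
    rwa [m.radius_zero] at this
  filter_upwards [(h0.eventually hρ).eventually_nhds] with z hz hz0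
  have hβ := m.exponent_add_one_pos ν.point
  by_cases hk : ν.k = 0
  · have h1 : HarmonicAt (C • ((m.exponent ν.point + 1) • (fun w : ℂ => ((Real.log ‖w‖ : ℝ) : ℂ))
        - fun _ => ((Real.log (m.exponent ν.point + 1) : ℝ) : ℂ))) z :=
      (((harmonicAt_ofReal_log_norm hz0).const_smul).sub (harmonicAt_const _)).const_smul
    refine (harmonicAt_congr_nhds ?_).2 h1
    filter_upwards [hz, isOpen_ne.mem_nhds hz0] with w hw hw0
    have hn : 0 < ‖w‖ := norm_pos_iff.2 hw0
    rw [singularChart, if_pos hk, hw, radius, Real.log_div (Real.rpow_pos_of_pos hn _).ne' hβ.ne',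
      Real.log_rpow hn]
    simp
  · have h1 : HarmonicAt ((C * ((m.exponent ν.point + 1) ^ (-|ν.value|))⁻¹) •
        fun w : ℂ => ((‖w‖ ^ (-|(ν.k : ℝ)|) : ℝ) : ℂ) * (w / (‖w‖ : ℂ)) ^ ν.k) z :=
      (harmonicAt_norm_rpow_mul_zpow ν.k hz0).const_smul
    refine (harmonicAt_congr_nhds ?_).2 h1
    filter_upwards [hz] with w hw
    rw [singularChart, if_neg hk, hw, m.radius_rpow]
    have : (m.exponent ν.point + 1) * -|ν.value| = -|(ν.k : ℝ)| := by
      rw [abs_value]; field_simp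
    rw [this, Pi.smul_apply, Complex.real_smul]
    push_cast
    ring

/-- The logarithm is absorbed into a power of `r` with exponent above `-1`, so that the cases `k =
0` and `k ≠ 0` share one integrability estimate. -/
theorem abs_log_le {r δ : ℝ} (hr : 0 < r) (hδ : r ≤ δ) :
    |Real.log r| ≤ 2 * (δ + 1) * r ^ (-(1 / 2 : ℝ)) := by
  have h1 := Real.log_le_rpow_div hr.le (ε := 1 / 2) (by norm_num)
  have h2 := Real.log_le_rpow_div (inv_pos.2 hr).le (ε := 1 / 2) (by norm_num)
  rw [Real.log_inv, Real.inv_rpow hr.le, ← Real.rpow_neg hr.le] at h2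
  have h3 : r ^ (1 / 2 : ℝ) = r * r ^ (-(1 / 2 : ℝ)) := by
    rw [← Real.rpow_one_add' hr.le (by norm_num)]; norm_num
  have h4 : 0 < r ^ (-(1 / 2 : ℝ)) := Real.rpow_pos_of_pos hr _
  rw [h3] at h1
  rw [abs_le]
  constructor <;> nlinarith [mul_le_mul_of_nonneg_right hδ h4.le]

/-- The singular functions are square integrable. -/
theorem exists_norm_singularChart_le (hρ : Continuous ρ) {δ : ℝ} (hδ : ∀ t, δ ≤ t → ρ t = 0) :
    ∃ s M : ℝ, -2 < 2 * m.exponent ν.point + 2 * s ∧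
      ∀ z ≠ 0, ‖singularChart C ρ ν z‖ ≤ M * ‖z‖ ^ s := by
  have hβ := m.exponent_add_one_pos ν.point
  obtain ⟨B, hB⟩ := (isCompact_Icc (a := (0 : ℝ)) (b := δ)).exists_bound_of_continuousOn
    hρ.continuousOn
  have key : ∃ a M : ℝ, a < 1 ∧
      ∀ z ≠ 0, ‖singularChart C ρ ν z‖ ≤ M * m.radius ν.point z ^ (-a) := by
    by_cases hk : ν.k = 0
    · refine ⟨1 / 2, |C| * (2 * (|δ| + 1)) * |B|, by norm_num, fun z hz => ?_⟩
      have hr := m.radius_pos ν.point hz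
      rw [singularChart, if_pos hk, Complex.norm_real, Real.norm_eq_abs, abs_mul, abs_mul]
      rcases le_total δ (m.radius ν.point z) with h | h
      · rw [hδ _ h, abs_zero, mul_zero]; positivity
      · have h1 := abs_log_le hr (h.trans (le_abs_self δ))
        have h2 : |ρ (m.radius ν.point z)| ≤ |B| := (hB _ ⟨hr.le, h⟩).trans (le_abs_self B)
        calc |C| * |Real.log (m.radius ν.point z)| * |ρ (m.radius ν.point z)|
            ≤ |C| * (2 * (|δ| + 1) * m.radius ν.point z ^ (-(1 / 2 : ℝ))) * |B| := by gcongr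
          _ = _ := by ring
    · refine ⟨|ν.value|, |C| * |B|, abs_value_lt_one ν, fun z hz => ?_⟩
      have hr := m.radius_pos ν.point hz
      have hn : ‖(z / (‖z‖ : ℂ)) ^ ν.k‖ = 1 := by
        rw [norm_zpow, norm_div, Complex.norm_real, norm_norm,
          div_self (norm_ne_zero_iff.2 hz), one_zpow]
      rw [singularChart, if_neg hk, norm_mul, hn, mul_one, Complex.norm_real, Real.norm_eq_abs,
        abs_mul, abs_mul, abs_of_pos (Real.rpow_pos_of_pos hr _)]
      rcases le_total δ (m.radius ν.point z) with h | h
      · rw [hδ _ h, abs_zero, mul_zero]; positivity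
      · have h2 : |ρ (m.radius ν.point z)| ≤ |B| := (hB _ ⟨hr.le, h⟩).trans (le_abs_self B)
        calc |C| * m.radius ν.point z ^ (-|ν.value|) * |ρ (m.radius ν.point z)|
            ≤ |C| * m.radius ν.point z ^ (-|ν.value|) * |B| := by gcongr
          _ = _ := by ring
  obtain ⟨a, M, ha, hM⟩ := key
  -- With `s = -(b + 1)a`, the condition `2b + 2s > -2` reads `(b + 1)(1 - a) > 0`.
  refine ⟨(m.exponent ν.point + 1) * -a, M * ((m.exponent ν.point + 1) ^ (-a))⁻¹, by nlinarith,
    fun z hz => (hM z hz).trans_eq ?_⟩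
  rw [m.radius_rpow]
  ring

theorem measurable_singularChart (hρ : Continuous ρ) : Measurable (singularChart C ρ ν) := by
  have hr := (m.continuous_radius ν.point).measurable
  have hρr : Measurable fun z => ρ (m.radius ν.point z) := hρ.measurable.comp hr
  by_cases hk : ν.k = 0
  · have : singularChart C ρ ν = fun z =>
        ((C * Real.log (m.radius ν.point z) * ρ (m.radius ν.point z) : ℝ) : ℂ) :=
      funext fun z => if_pos hk
    rw [this]
    fun_prop
  · have : singularChart C ρ ν = fun z =>
        ((C * m.radius ν.point z ^ (-|ν.value|) * ρ (m.radius ν.point z) : ℝ) : ℂ)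
          * (z / (‖z‖ : ℂ)) ^ ν.k := funext fun z => if_neg hk
    rw [this]
    have h2 : Measurable fun z : ℂ => (z / (‖z‖ : ℂ)) ^ ν.k := by
      cases ν.k with
      | ofNat n => simp only [Int.ofNat_eq_natCast, zpow_natCast]; fun_prop
      | negSucc n => simp only [zpow_negSucc]; fun_prop
    fun_prop

end

end FlatConicalMetric

/-! ### The resolvent identity and the derivative of the S-matrix -/

namespace FlatConicalMetric

variable {X : Type*} [TopologicalSpace X] [ChartedSpace ℂ X] [IsManifold 𝓘(ℂ) ω X]
  [MeasurableSpace X] {m : FlatConicalMetric X} (C : m.Index → ℝ) (ρ : m.Index → ℝ → ℝ)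

section

variable (hT : Dense (m.laplaceMin.domain : Set m.L2))
  (hsym : m.laplaceMin.IsFormalAdjoint m.laplaceMin)
  (hpos : ∀ u : m.laplaceMin.domain, 0 ≤ (inner ℂ (u : m.L2) (m.laplaceMin u)).re)

include hT hsym hpos

theorem bijective_shiftF {lam : ℂ} (hlam : ∀ t : ℝ, 0 ≤ t → lam ≠ t) :
    Function.Bijective (m.shiftF lam) := by
  obtain ⟨R, hR1, hR2⟩ := LinearPMap.exists_friedrichs_resolvent hT hsym hpos hlam
  refine ⟨fun u v huv => ?_, fun y => ?_⟩
  · exact Subtype.ext ((hR2 u).symm.trans ((congrArg R huv).trans (hR2 v)))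
  · obtain ⟨u, -, hu⟩ := hR1 y
    exact ⟨u, hu⟩

theorem exists_norm_le_shiftF {lam : ℂ} (hlam : ∀ t : ℝ, 0 ≤ t → lam ≠ t) :
    ∃ K : ℝ, 0 ≤ K ∧ ∀ u : m.laplaceF.domain, ‖(u : m.L2)‖ ≤ K * ‖m.shiftF lam u‖ := by
  obtain ⟨R, -, hR2⟩ := LinearPMap.exists_friedrichs_resolvent hT hsym hpos hlam
  refine ⟨‖R‖, norm_nonneg _, fun u => ?_⟩
  have h := R.le_opNorm (m.shiftF lam u)
  rwa [show R (m.shiftF lam u) = u from hR2 u] at h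

theorem shiftF_g (ν : m.Index) {lam : ℂ} (hlam : ∀ t : ℝ, 0 ≤ t → lam ≠ t) :
    m.shiftF lam (m.g C ρ ν lam) = -m.f C ρ ν lam := by
  have h : m.shiftF lam (m.resolventF lam (m.f C ρ ν lam)) = m.f C ρ ν lam :=
    Function.rightInverse_invFun (bijective_shiftF hT hsym hpos hlam).2 _
  refine Eq.trans ?_ (congrArg Neg.neg h)
  rw [g, shiftF, shiftF, LinearPMap.map_neg, Submodule.coe_neg]
  module

omit hT hsym hpos in
theorem not_nonneg_conj {lam : ℂ} (hlam : ∀ t : ℝ, 0 ≤ t → lam ≠ t) :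
    ∀ t : ℝ, 0 ≤ t → starRingEnd ℂ lam ≠ t := fun t ht h => hlam t ht (by
  rw [← Complex.conj_conj lam, h, Complex.conj_ofReal])

/-- The terms `λ⟨u, F_ν⟩` added to both halves of `𝒢(u, F_ν)` cancel. What remains of the second
half is `-⟨u, (Δ* - λ)F_ν⟩ = ⟨u, (Δ_F - λ)g_ν⟩`, and symmetry of `Δ_F` moves the operator to `u`.
This also proves that `G_ν` exists. -/
theorem Lam_eq (ν : m.Index) {lam : ℂ} (hlam : ∀ t : ℝ, 0 ≤ t → lam ≠ t)
    (u : m.laplaceF.domain) :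
    m.Lam C ρ ν u = m.pairing (m.shiftF (starRingEnd ℂ lam) u)
      ((m.F C ρ ν : m.L2) + m.g C ρ ν lam) := by
  have h1 := shiftF_g C ρ hT hsym hpos ν hlam
  have h2 : inner ℂ (m.g C ρ ν lam : m.L2) (m.shiftF (starRingEnd ℂ lam) u)
      = inner ℂ (m.shiftF lam (m.g C ρ ν lam)) (u : m.L2) := by
    have := LinearPMap.friedrichs_symmetric hT hsym hpos (m.g C ρ ν lam) u
    rw [shiftF, shiftF, inner_sub_left, inner_sub_right, inner_smul_left, inner_smul_right]
    exact congrArg (· - _) this.symm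
  have h3 : m.laplaceMax ⟨u, m.laplaceF_le_laplaceMax.1 u.2⟩ = m.laplaceF u :=
    (m.laplaceF_le_laplaceMax.2 rfl).symm
  rw [pairing, inner_add_left, h2, h1, Lam, greenForm, pairing, pairing, h3, f, shiftF,
    inner_sub_right, inner_neg_left, inner_sub_left, inner_smul_left, inner_smul_right]
  ring

theorem Lam_eq_pairing_G (ν : m.Index) {lam : ℂ} (hlam : ∀ t : ℝ, 0 ≤ t → lam ≠ t)
    (u : m.laplaceF.domain) :
    m.Lam C ρ ν u = m.pairing (m.shiftF (starRingEnd ℂ lam) u) (m.G C ρ ν lam) :=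
  Classical.epsilon_spec (p := fun v => ∀ u : m.laplaceF.domain,
    m.Lam C ρ ν u = m.pairing (m.shiftF (starRingEnd ℂ lam) u) v)
    ⟨_, Lam_eq C ρ hT hsym hpos ν hlam⟩ u

/-- The defining relation determines `G_ν` uniquely, because `Δ_F - λ̄` is onto. -/
theorem G_eq (ν : m.Index) {lam : ℂ} (hlam : ∀ t : ℝ, 0 ≤ t → lam ≠ t) :
    m.G C ρ ν lam = (m.F C ρ ν : m.L2) + m.g C ρ ν lam := by
  refine ext_inner_right ℂ fun v => ?_
  obtain ⟨u, rfl⟩ := (bijective_shiftF hT hsym hpos (not_nonneg_conj hlam)).2 v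
  exact (Lam_eq_pairing_G C ρ hT hsym hpos ν hlam u).symm.trans (Lam_eq C ρ hT hsym hpos ν hlam u)

theorem shiftF_g_sub_g (ν : m.Index) {lam lam₀ : ℂ} (hlam : ∀ t : ℝ, 0 ≤ t → lam ≠ t)
    (hlam₀ : ∀ t : ℝ, 0 ≤ t → lam₀ ≠ t) :
    m.shiftF lam (m.g C ρ ν lam - m.g C ρ ν lam₀) = (lam - lam₀) • m.G C ρ ν lam₀ := by
  have h1 := shiftF_g C ρ hT hsym hpos ν hlam
  have h2 := shiftF_g C ρ hT hsym hpos ν hlam₀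
  rw [shiftF, f] at h1 h2
  rw [G_eq C ρ hT hsym hpos ν hlam₀, shiftF, LinearPMap.map_sub, Submodule.coe_sub]
  linear_combination (norm := module) h1 - h2

omit hT hsym hpos in
theorem eventually_not_nonneg {lam₀ : ℂ} (hlam₀ : ∀ t : ℝ, 0 ≤ t → lam₀ ≠ t) :
    ∀ᶠ lam : ℂ in nhds lam₀, ∀ t : ℝ, 0 ≤ t → lam ≠ t := by
  have hc : IsClosed ((fun t : ℝ => (t : ℂ)) '' Set.Ici 0) :=
    Complex.isometry_ofReal.isClosedEmbedding.isClosedMap _ isClosed_Ici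
  have hm : lam₀ ∈ ((fun t : ℝ => (t : ℂ)) '' Set.Ici 0)ᶜ := by
    rintro ⟨t, ht, rfl⟩
    exact hlam₀ t ht rfl
  filter_upwards [hc.isOpen_compl.mem_nhds hm] with lam h t ht hl
  exact h ⟨t, ht, hl.symm⟩

theorem continuousAt_G (ν : m.Index) {lam₀ : ℂ} (hlam₀ : ∀ t : ℝ, 0 ≤ t → lam₀ ≠ t) :
    ContinuousAt (m.G C ρ ν) lam₀ := by
  obtain ⟨K, hK, hR⟩ := exists_norm_le_shiftF hT hsym hpos hlam₀
  have hdiff : ∀ lam : ℂ, (∀ t : ℝ, 0 ≤ t → lam ≠ t) →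
      ‖m.G C ρ ν lam - m.G C ρ ν lam₀‖ ≤ K * (‖lam - lam₀‖ * ‖m.G C ρ ν lam‖) := by
    intro lam hlam
    -- The two parameters are interchanged on purpose: only the resolvent at the fixed `lam₀` has to
    -- be bounded, at the price of `‖G(lam)‖` on the right.
    have h1 := shiftF_g_sub_g C ρ hT hsym hpos ν hlam₀ hlam
    have h2 := hR (m.g C ρ ν lam₀ - m.g C ρ ν lam)
    rw [h1, norm_smul, norm_sub_rev lam₀, Submodule.coe_sub] at h2
    rw [norm_sub_rev]
    refine le_trans (le_of_eq ?_) h2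
    rw [G_eq C ρ hT hsym hpos ν hlam₀, G_eq C ρ hT hsym hpos ν hlam, add_sub_add_left_eq_sub]
  have hsmall : ∀ᶠ lam in nhds lam₀, K * ‖lam - lam₀‖ < 1 / 2 := by
    have : Filter.Tendsto (fun lam => K * ‖lam - lam₀‖) (nhds lam₀) (nhds (K * ‖lam₀ - lam₀‖)) :=
      ContinuousAt.tendsto (by fun_prop)
    rw [sub_self, norm_zero, mul_zero] at this
    exact this.eventually_lt_const (by norm_num)
  rw [ContinuousAt, tendsto_iff_norm_sub_tendsto_zero]
  have hlim : Filter.Tendsto (fun lam => K * (‖lam - lam₀‖ * (2 * ‖m.G C ρ ν lam₀‖)))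
      (nhds lam₀) (nhds 0) := by
    have : Filter.Tendsto (fun lam => K * (‖lam - lam₀‖ * (2 * ‖m.G C ρ ν lam₀‖)))
      (nhds lam₀) (nhds (K * (‖lam₀ - lam₀‖ * (2 * ‖m.G C ρ ν lam₀‖)))) :=
        ContinuousAt.tendsto (by fun_prop)
    simpa using this
  refine squeeze_zero' (Filter.Eventually.of_forall fun _ => norm_nonneg _) ?_ hlim
  filter_upwards [hsmall, eventually_not_nonneg hlam₀] with lam h1 hlam
  have h2 := hdiff lam hlam
  -- Close to `lam₀` the difference is at most `½ ‖G(lam)‖`, which is absorbed into the left side.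
  have h3 : ‖m.G C ρ ν lam‖ ≤ 2 * ‖m.G C ρ ν lam₀‖ := by
    have h4 := norm_sub_norm_le (m.G C ρ ν lam) (m.G C ρ ν lam₀)
    nlinarith [norm_nonneg (m.G C ρ ν lam)]
  refine h2.trans ?_
  gcongr

theorem hasDerivAt_S (μ ν : m.Index) {lam : ℂ} (hlam : ∀ t : ℝ, 0 ≤ t → lam ≠ t) :
    HasDerivAt (m.S C ρ μ ν)
      (m.pairing (m.G C ρ ν lam) (m.G C ρ μ (starRingEnd ℂ lam))) lam := by
  have hsub : ∀ u v : m.laplaceF.domain,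
      m.Lam C ρ μ (u - v) = m.Lam C ρ μ u - m.Lam C ρ μ v := by
    intro u v
    simp only [Lam_eq_pairing_G C ρ hT hsym hpos μ hlam, pairing, ← inner_sub_right]
    congr 1
    rw [shiftF, shiftF, shiftF, LinearPMap.map_sub, Submodule.coe_sub]
    module
  -- Representing `Λ_μ` by `G_μ` at `z̄` produces the operator `Δ_F - z`, which sends `g_ν(z) -
  -- g_ν(lam)` to `(z - lam)G_ν(lam)`.
  have hS : ∀ z : ℂ, (∀ t : ℝ, 0 ≤ t → z ≠ t) → m.S C ρ μ ν z - m.S C ρ μ ν lam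
      = (z - lam) * m.pairing (m.G C ρ ν lam) (m.G C ρ μ (starRingEnd ℂ z)) := by
    intro z hz
    rw [S, S, ← hsub, Lam_eq_pairing_G C ρ hT hsym hpos μ (not_nonneg_conj hz), Complex.conj_conj,
      shiftF_g_sub_g C ρ hT hsym hpos ν hz hlam, pairing, inner_smul_right, pairing]
  rw [hasDerivAt_iff_tendsto_slope]
  have hcont : ContinuousAt (fun z => m.pairing (m.G C ρ ν lam) (m.G C ρ μ (starRingEnd ℂ z)))
      lam := by
    have h1 := continuousAt_G C ρ hT hsym hpos μ (not_nonneg_conj hlam)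
    have h2 : ContinuousAt (fun z => m.G C ρ μ (starRingEnd ℂ z)) lam :=
      ContinuousAt.comp (f := starRingEnd ℂ) h1 Complex.continuous_conj.continuousAt
    exact h2.inner continuousAt_const
  refine (hcont.tendsto.mono_left nhdsWithin_le_nhds).congr' ?_
  filter_upwards [nhdsWithin_le_nhds (eventually_not_nonneg hlam), self_mem_nhdsWithin] with z hz hne
  rw [slope_def_field, hS z hz, mul_div_cancel_left₀ _ (sub_ne_zero.2 hne)]

end

end FlatConicalMetric

/-! ### Membership of the singular functions in the maximal domain -/

namespace FlatConicalMetric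

open Filter Topology MeasureTheory

section

variable {X : Type*} [TopologicalSpace X] [CompactSpace X] [T2Space X] [ChartedSpace ℂ X]
  [IsManifold 𝓘(ℂ) ω X] {m : FlatConicalMetric X} {C : ℝ} {ρ : ℝ → ℝ} {ν : m.Index}

omit [CompactSpace X] in
-- The function vanishes outside the image `K` of `{r ≤ δ}`, which is compact and therefore closed
-- in the Hausdorff space `X`; so extension by zero creates no jump at the edge of the parameter
-- domain.
theorem singularFun_eventuallyEq_zero (hρ : m.IsCutoff ν.point ρ) {x : X}
    (hx : x ∉ (m.chart ν.point).source) : m.singularFun C ρ ν =ᶠ[𝓝 x] 0 := by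
  obtain ⟨-, -, δ, hδ, hK⟩ := hρ
  set K := (m.chart ν.point).symm '' {z | m.radius ν.point z ≤ δ}
  have hKc : IsCompact K := (m.isCompact_radius_le ν.point).image_of_continuousOn
    ((m.chart ν.point).continuousOn_symm.mono hK)
  have hxK : x ∉ K := by
    rintro ⟨z, hz, rfl⟩
    exact hx ((m.chart ν.point).map_target (hK hz))
  filter_upwards [hKc.isClosed.isOpen_compl.mem_nhds hxK] with y hy
  rw [singularFun_eq_indicator]
  by_cases hys : y ∈ (m.chart ν.point).source
  · have hlt : δ ≤ m.radius ν.point (m.chart ν.point y) := by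
      by_contra h
      exact hy ⟨_, (not_le.1 h).le, (m.chart ν.point).left_inv hys⟩
    rw [Set.indicator_of_mem hys, Function.comp_apply, singularChart, hδ _ hlt]
    simp
  · rw [Set.indicator_of_notMem hys]; rfl

omit [CompactSpace X] [T2Space X] in
theorem singularFun_eventuallyEq {x : X} (hx : x ∈ (m.chart ν.point).source) :
    m.singularFun C ρ ν =ᶠ[𝓝 x] singularChart C ρ ν ∘ m.chart ν.point := by
  filter_upwards [(m.chart ν.point).open_source.mem_nhds hx] with y hy
  rw [singularFun_eq_indicator, Set.indicator_of_mem hy]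

omit [CompactSpace X] in
theorem contMDiffAt_singularFun (hρ : m.IsCutoff ν.point ρ) {x : X} (hx : x ≠ ν.point) :
    ContMDiffAt 𝓘(ℝ, ℂ) 𝓘(ℝ, ℂ) 2 (m.singularFun C ρ ν) x := by
  by_cases hxs : x ∈ (m.chart ν.point).source
  · refine ContMDiffAt.congr_of_eventuallyEq ?_ (singularFun_eventuallyEq hxs)
    exact ((contDiffAt_singularChart hρ.1 (m.chart_ne_zero hxs hx)).of_le
      ENat.LEInfty.out).contMDiffAt.comp x ((m.contMDiffAt_chart hxs).of_le ENat.LEInfty.out)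
  · exact contMDiffAt_const.congr_of_eventuallyEq (singularFun_eventuallyEq_zero hρ hxs)

omit [CompactSpace X] [T2Space X] in
theorem ne_point_of_smooth {x : X} (hx : m.exponent x = 0) : x ≠ ν.point := fun h =>
  ν.conical (h ▸ hx)

omit [CompactSpace X] [T2Space X] in
theorem eventually_laplacian_singularFun (hρ : m.IsCutoff ν.point ρ) :
    ∀ᶠ x in 𝓝 ν.point, x ≠ ν.point → m.laplacian (m.singularFun C ρ ν) x = 0 := by
  have hs := m.mem_source ν.point
  have hc := (m.chart ν.point).continuousAt hs
  rw [ContinuousAt, m.chart_self] at hc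
  filter_upwards [hc.eventually (eventually_harmonicAt_singularChart (C := C) (ν := ν) hρ.2.1),
    (m.chart ν.point).open_source.mem_nhds hs] with x hx hxs hne
  have h0 := m.exponent_eq_zero hxs hne
  have hz := m.chart_ne_zero hxs hne
  have hsm : ContMDiffAt 𝓘(ℝ, ℂ) 𝓘(ℝ, ℂ) 2 (m.singularFun C ρ ν) x := by
    refine ContMDiffAt.congr_of_eventuallyEq ?_ (singularFun_eventuallyEq hxs)
    exact ((contDiffAt_singularChart hρ.1 hz).of_le
      ENat.LEInfty.out).contMDiffAt.comp x ((m.contMDiffAt_chart hxs).of_le ENat.LEInfty.out)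
  have h1 := m.laplacian_chart hxs h0 hsm
  have h2 : m.singularFun C ρ ν ∘ (m.chart ν.point).symm =ᶠ[𝓝 (m.chart ν.point x)]
      singularChart C ρ ν := by
    filter_upwards [(m.chart ν.point).open_target.mem_nhds ((m.chart ν.point).map_source hxs)]
      with z hz
    rw [singularFun_eq_indicator, Function.comp_apply,
      Set.indicator_of_mem ((m.chart ν.point).map_target hz), Function.comp_apply,
      (m.chart ν.point).right_inv hz]
  rw [(InnerProductSpace.laplacian_congr_nhds h2).eq_of_nhds, (hx hz).2.self_of_nhds] at h1
  simpa [(m.norm_rpow_pos hxs h0).ne'] using h1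

omit [CompactSpace X] in
-- The Laplacian vanishes in a punctured neighbourhood of the conical point, where its own value
-- carries no meaning. Resetting that one value to `0` gives a continuous function on a compact
-- space, hence a square integrable one.
theorem continuous_update_laplacian_singularFun [DecidableEq X] (hρ : m.IsCutoff ν.point ρ) :
    Continuous (Function.update (m.laplacian (m.singularFun C ρ ν)) ν.point 0) := by
  rw [continuous_iff_continuousAt]
  intro x
  by_cases hx : x = ν.point
  · subst hx
    refine (continuousAt_const (y := (0 : ℂ))).congr ?_
    filter_upwards [eventually_laplacian_singularFun (C := C) hρ] with y hy
    by_cases h : y = ν.point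
    · rw [h, Function.update_self]
    · rw [Function.update_of_ne h, hy h]
  · have hev : m.laplacian (m.singularFun C ρ ν)
        =ᶠ[𝓝 x] Function.update (m.laplacian (m.singularFun C ρ ν)) ν.point 0 := by
      filter_upwards [isOpen_ne.mem_nhds hx] with y hy
      rw [Function.update_of_ne hy]
    refine ContinuousAt.congr ?_ hev
    by_cases hxs : x ∈ (m.chart ν.point).source
    · exact m.continuousAt_laplacian (m.exponent_eq_zero hxs hx) (contMDiffAt_singularFun hρ hx)
    · refine (continuousAt_const (y := (0 : ℂ))).congr ?_
      filter_upwards [(singularFun_eventuallyEq_zero (C := C) hρ hxs).eventually_nhds] with y hy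
      exact (m.laplacian_eq_zero_of_notMem_tsupport
        (notMem_tsupport_iff_eventuallyEq.2 hy)).symm

variable [MeasurableSpace X] [BorelSpace X]

variable (m) in
theorem area_singleton (p : X) : m.area {p} = 0 := by
  have h1 : m.area {p} = m.localArea p {p} := by
    rw [← m.area_restrict_source p, Measure.restrict_apply (measurableSet_singleton p),
      Set.inter_eq_self_of_subset_left (Set.singleton_subset_iff.2 (m.mem_source p))]
  rw [h1, m.localArea_apply p (measurableSet_singleton p)]
  refine setLIntegral_measure_zero _ _ (measure_mono_null (t := {0}) ?_ (measure_singleton 0))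
  rintro z ⟨hz, hz'⟩
  rw [Set.mem_preimage, Set.mem_singleton_iff] at hz'
  rw [Set.mem_singleton_iff, ← (m.chart p).right_inv hz, hz', m.chart_self]

theorem memLp_laplacian_singularFun (hρ : m.IsCutoff ν.point ρ) :
    MemLp (m.laplacian (m.singularFun C ρ ν)) 2 m.area := by
  classical
  refine (m.memLp_of_continuous
    (continuous_update_laplacian_singularFun (C := C) hρ)).ae_eq ?_
  have : ∀ᵐ x ∂m.area, x ≠ ν.point := compl_mem_ae_iff.2 (m.area_singleton _)
  filter_upwards [this] with x hx
  rw [Function.update_of_ne hx]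

omit [CompactSpace X] [T2Space X] in
theorem measurable_singularFun (hρ : m.IsCutoff ν.point ρ) :
    Measurable (m.singularFun C ρ ν) := by
  classical
  have hs := (m.chart ν.point).open_source.measurableSet
  have h1 : Measurable ((m.chart ν.point).source.piecewise (m.chart ν.point) fun _ => 0) :=
    (m.chart ν.point).continuousOn.measurable_piecewise continuousOn_const hs
  have h2 : m.singularFun C ρ ν = (m.chart ν.point).source.indicator (singularChart C ρ ν ∘
      (m.chart ν.point).source.piecewise (m.chart ν.point) fun _ => 0) := by
    rw [singularFun_eq_indicator]
    refine Set.indicator_congr fun x hx => ?_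
    rw [Function.comp_apply, Function.comp_apply, Set.piecewise_eq_of_mem _ _ _ hx]
  rw [h2]
  exact ((measurable_singularChart hρ.1.continuous).comp h1).indicator hs

omit [T2Space X] in
-- In the parameter, the squared modulus times the area density is at most a constant times
-- `|z|^(2b+2s)` on a disc, with `2b + 2s > -2`, and it is zero outside the disc.
theorem memLp_singularFun (hρ : m.IsCutoff ν.point ρ) : MemLp (m.singularFun C ρ ν) 2 m.area := by
  have hmeas := measurable_singularFun (C := C) hρ
  have hsupp : ∀ x ∉ (m.chart ν.point).source, m.singularFun C ρ ν x = 0 := fun x hx => by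
    rw [singularFun_eq_indicator, Set.indicator_of_notMem hx]
  obtain ⟨hρ1, -, δ, hδ, -⟩ := hρ
  obtain ⟨s, M, hs, hM⟩ := exists_norm_singularChart_le (C := C) (ν := ν) hρ1.continuous hδ
  obtain ⟨R, hR⟩ := (m.isCompact_radius_le ν.point (δ := δ)).isBounded.subset_ball (0 : ℂ)
  have hR0 : ∀ z, z ∉ Metric.ball (0 : ℂ) R → singularChart C ρ ν z = 0 := fun z hz => by
    have h : δ ≤ m.radius ν.point z := (not_le.1 fun h => hz (hR h)).le
    rw [singularChart, hδ _ h]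
    simp
  refine ⟨hmeas.aestronglyMeasurable, ?_⟩
  rw [eLpNorm_lt_top_iff_lintegral_rpow_enorm_lt_top two_ne_zero ENNReal.ofNat_ne_top]
  have hmeas2 : AEMeasurable (fun x => ‖m.singularFun C ρ ν x‖ₑ ^ (2 : ENNReal).toReal) m.area :=
    (hmeas.enorm.pow_const _).aemeasurable
  rw [m.lintegral_area hmeas2 ν.point fun x hx => by simp [hsupp x hx]]
  have hint : IntegrableOn (fun z : ℂ => M ^ 2 * ‖z‖ ^ (2 * m.exponent ν.point + 2 * s))
      (Metric.ball 0 R) := (integrableOn_norm_rpow_ball hs R).const_mul _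
  have hfin : ∫⁻ z in Metric.ball (0 : ℂ) R,
      ENNReal.ofReal (M ^ 2 * ‖z‖ ^ (2 * m.exponent ν.point + 2 * s)) < ⊤ :=
    hint.lintegral_lt_top
  refine lt_of_le_of_lt ?_ hfin
  rw [← lintegral_indicator Metric.isOpen_ball.measurableSet,
    ← lintegral_indicator (m.chart ν.point).open_target.measurableSet]
  refine lintegral_mono_ae ?_
  filter_upwards [compl_mem_ae_iff.2 (measure_singleton (μ := volume) (0 : ℂ))] with z hz
  replace hz : z ≠ 0 := hz
  by_cases hzt : z ∈ (m.chart ν.point).target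
  · rw [Set.indicator_of_mem hzt, singularFun_eq_indicator,
      Set.indicator_of_mem ((m.chart ν.point).map_target hzt), Function.comp_apply,
      (m.chart ν.point).right_inv hzt]
    by_cases hzR : z ∈ Metric.ball (0 : ℂ) R
    · have hn : 0 < ‖z‖ := norm_pos_iff.2 hz
      rw [Set.indicator_of_mem hzR, ← ofReal_norm,
        ENNReal.ofReal_rpow_of_nonneg (norm_nonneg _) (by simp),
        ← ENNReal.ofReal_mul (by positivity)]
      refine ENNReal.ofReal_le_ofReal ?_
      have h1 : ‖singularChart C ρ ν z‖ ^ (2 : ENNReal).toReal ≤ (M * ‖z‖ ^ s) ^ 2 := by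
        rw [ENNReal.toReal_ofNat, Real.rpow_ofNat]
        exact pow_le_pow_left₀ (norm_nonneg _) (hM z hz) 2
      calc _ ≤ ‖z‖ ^ (2 * m.exponent ν.point) * (M * ‖z‖ ^ s) ^ 2 := by gcongr
        _ = _ := by
          rw [Real.rpow_add hn, mul_comm 2 s, Real.rpow_mul hn.le s 2, Real.rpow_ofNat]
          ring
    · rw [Set.indicator_of_notMem hzR, hR0 z hzR]
      simp
  · rw [Set.indicator_of_notMem hzt]
    exact zero_le

end

/-- `F_ν` is a choice among the elements of `dom Δ*` represented by the singular function; what has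
to be shown is that there is one. -/
theorem F_ae_eq {X : Type*} [TopologicalSpace X] [CompactSpace X] [T2Space X]
    [ChartedSpace ℂ X] [IsManifold 𝓘(ℂ) ω X] [MeasurableSpace X] [BorelSpace X]
    (m : FlatConicalMetric X) (C : m.Index → ℝ) {ρ : m.Index → ℝ → ℝ}
    (hρ : ∀ ν, m.IsCutoff ν.point (ρ ν)) (ν : m.Index) :
    (m.F C ρ ν : m.L2) =ᵐ[m.area] m.singularFun (C ν) (ρ ν) ν :=
  Classical.epsilon_spec (p := fun u : m.laplaceMax.domain =>
    (u : m.L2) =ᵐ[m.area] m.singularFun (C ν) (ρ ν) ν)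
    (m.exists_mem_laplaceMax
      (fun _ hx => contMDiffAt_singularFun (hρ ν) (ne_point_of_smooth hx))
      (memLp_singularFun (hρ ν)) (memLp_laplacian_singularFun (hρ ν)))

end FlatConicalMetric

theorem mainTheorem9 {X : Type*} [TopologicalSpace X] [CompactSpace X] [T2Space X]
    [ChartedSpace ℂ X] [IsManifold 𝓘(ℂ) ω X] [MeasurableSpace X] [BorelSpace X]
    (m : FlatConicalMetric X)
    (C : m.Index → ℝ) (ρ : m.Index → ℝ → ℝ) (hρ : ∀ ν, m.IsCutoff ν.point (ρ ν)) :
    -- the functions `F_ν` belong to `dom Δ*`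
    (∀ ν, (m.F C ρ ν : m.L2) =ᵐ[m.area] m.singularFun (C ν) (ρ ν) ν) ∧
    ∀ lam : ℂ, (∀ t : ℝ, 0 ≤ t → lam ≠ t) →
      -- `lam` is in the resolvent set of `Δ_F`
      Function.Bijective (m.shiftF lam) ∧
      -- `G_ν(·; lam)` satisfies its defining relation
      (∀ ν u, m.Lam C ρ ν u =
        m.pairing (m.shiftF (starRingEnd ℂ lam) u) (m.G C ρ ν lam)) ∧
      -- the formula for the derivative of the S-matrix
      ∀ μ ν, HasDerivAt (m.S C ρ μ ν)
        (m.pairing (m.G C ρ ν lam) (m.G C ρ μ (starRingEnd ℂ lam))) lam := by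
  obtain ⟨hT, hsym, hpos, -⟩ := m.laplaceMin_properties
  exact ⟨m.F_ae_eq C hρ, fun lam hlam =>
    ⟨FlatConicalMetric.bijective_shiftF hT hsym hpos hlam,
      fun ν u => FlatConicalMetric.Lam_eq_pairing_G C ρ hT hsym hpos ν hlam u,
      fun μ ν => FlatConicalMetric.hasDerivAt_S C ρ hT hsym hpos μ ν hlam⟩⟩
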